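/- Let $a<b$ be real numbers and let $H_+^{AC}=H_+^{AC}([a,b])$ be the group, under composition, of all increasing homeomorphisms $f:[a,b]\to[a,b]$ such that both $f$ and $f^{-1}$ are absolutely continuous, with the topology of the metric $\rho(f,g)=\int_a^b|f'-g'|\,d\lambda$, where $\lambda$ is Lebesgue measure. For a Polish group $G$ and $n\in\mathbb{N}$ let $\Omega_n\subseteq G^n$ be the set of $n$-tuples that generate a dense subgroup of $G$. Call $G$ topologically $n$-generated if $\Omega_n\neq\emptyset$, and generically $n$-generated if $\Omega_n$ is comeagre in $G^n$ with the product topology; the least such $n$ is the topological rank, respectively the generic rank, of $G$ (with value $\aleph_0$ if no such finite $n$ exists). Then $H_+^{AC}$ is a Polish group, and it is generically $2$-generated: the set of pairs $(f,g)\in H_+^{AC}\times H_+^{AC}$ for which $\langle f,g\rangle$ is dense in $H_+^{AC}$ is a dense $G_\delta$ set, and so comeagre. Moreover $H_+^{AC}$ is not topologically $1$-generated, and its topological rank and its generic rank are both equal to $2$. -/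

import Mathlib

open Set MeasureTheory Topology

noncomputable section

/-- The self-map of `ℝ` that is `f` on `[a, b]` and the identity outside `[a, b]`. It only serves to
speak of the derivative and of the absolute continuity of `f : [a, b] → ℝ`. -/
def extendId {a b : ℝ} (f : Icc a b ≃ₜ Icc a b) (x : ℝ) : ℝ :=
  if hx : x ∈ Icc a b then (f ⟨x, hx⟩ : ℝ) else x

lemma extendId_of_mem {a b : ℝ} (f : Icc a b ≃ₜ Icc a b) {x : ℝ} (hx : x ∈ Icc a b) :
    extendId f x = f ⟨x, hx⟩ := dif_pos hx

lemma extendId_of_notMem {a b : ℝ} (f : Icc a b ≃ₜ Icc a b) {x : ℝ} (hx : x ∉ Icc a b) :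
    extendId f x = x := dif_neg hx

lemma extendId_mul {a b : ℝ} (f g : Icc a b ≃ₜ Icc a b) :
    extendId (f * g) = extendId f ∘ extendId g := by
  funext x
  by_cases hx : x ∈ Icc a b
  · simp only [Function.comp, extendId_of_mem _ hx, extendId_of_mem f (g ⟨x, hx⟩).2]
    rfl
  · simp only [Function.comp, extendId_of_notMem _ hx]

lemma extendId_one {a b : ℝ} : extendId (1 : Icc a b ≃ₜ Icc a b) = id := by
  funext x
  by_cases hx : x ∈ Icc a b
  · rw [extendId_of_mem _ hx]; rfl
  · rw [extendId_of_notMem _ hx]; rfl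

lemma extendId_mem_uIcc {a b : ℝ} (f : Icc a b ≃ₜ Icc a b) {x : ℝ} (hx : x ∈ uIcc a b) :
    extendId f x ∈ uIcc a b := by
  by_cases h : x ∈ Icc a b
  · rw [extendId_of_mem f h]; exact Icc_subset_uIcc (f ⟨x, h⟩).2
  · rwa [extendId_of_notMem f h]

lemma extendId_monotone {a b : ℝ} {f : Icc a b ≃ₜ Icc a b} (hf : StrictMono f) :
    Monotone (extendId f) := by
  intro x y hxy
  by_cases hx : x ∈ Icc a b <;> by_cases hy : y ∈ Icc a b
  · rw [extendId_of_mem f hx, extendId_of_mem f hy]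
    exact hf.monotone (show (⟨x, hx⟩ : Icc a b) ≤ ⟨y, hy⟩ from hxy)
  · rw [extendId_of_mem f hx, extendId_of_notMem f hy]
    have h1 := (f ⟨x, hx⟩).2
    simp only [mem_Icc, not_and, not_le] at hx hy h1
    have := hy (hx.1.trans hxy)
    linarith
  · rw [extendId_of_notMem f hx, extendId_of_mem f hy]
    have h1 := (f ⟨y, hy⟩).2
    simp only [mem_Icc, not_and, not_le] at hx hy h1
    by_contra! h
    have := hx (h1.1.trans h.le)
    linarith
  · rwa [extendId_of_notMem f hx, extendId_of_notMem f hy]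

lemma absolutelyContinuous_extendId_mul {a b : ℝ} {f g : Icc a b ≃ₜ Icc a b} (hg : StrictMono g)
    (hF : AbsolutelyContinuousOnInterval (extendId f) a b)
    (hG : AbsolutelyContinuousOnInterval (extendId g) a b) :
    AbsolutelyContinuousOnInterval (extendId (f * g)) a b := by
  rw [extendId_mul]
  rw [absolutelyContinuousOnInterval_iff] at hF hG ⊢
  intro ε hε
  obtain ⟨δ₁, hδ₁, h₁⟩ := hF ε hε
  obtain ⟨δ, hδ, h₂⟩ := hG δ₁ hδ₁
  refine ⟨δ, hδ, fun E hE hlen => ?_⟩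
  refine h₁ (E.1, fun i => (extendId g (E.2 i).1, extendId g (E.2 i).2)) ⟨?_, ?_⟩ (h₂ E hE hlen)
  · intro i hi
    exact ⟨extendId_mem_uIcc g (hE.1 i hi).1, extendId_mem_uIcc g (hE.1 i hi).2⟩
  · intro i hi j hj hij
    have h := hE.2 hi hj hij
    have hm := extendId_monotone hg
    simp only [Function.onFun, uIoc, Ioc_disjoint_Ioc] at h ⊢
    simp only [← hm.map_min, ← hm.map_max]
    exact hm h

/-- The group of increasing self-homeomorphisms `f` of `[a, b]` such that `f` and `f⁻¹` are
absolutely continuous, as a subgroup of the group of all self-homeomorphisms. -/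
def hPlusACSubgroup (a b : ℝ) : Subgroup (Icc a b ≃ₜ Icc a b) where
  carrier := {f | StrictMono f ∧ AbsolutelyContinuousOnInterval (extendId f) a b ∧
    AbsolutelyContinuousOnInterval (extendId f⁻¹) a b}
  one_mem' := by
    have h : AbsolutelyContinuousOnInterval (extendId (1 : Icc a b ≃ₜ Icc a b)) a b := by
      rw [extendId_one]
      exact (LipschitzWith.id.lipschitzOnWith (s := uIcc a b)).absolutelyContinuousOnInterval
    exact ⟨strictMono_id, h, by rwa [inv_one]⟩
  mul_mem' := by
    rintro f g ⟨hf, hf₁, hf₂⟩ ⟨hg, hg₁, hg₂⟩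
    refine ⟨hf.comp hg, absolutelyContinuous_extendId_mul hg hf₁ hg₁, ?_⟩
    rw [mul_inv_rev]
    refine absolutelyContinuous_extendId_mul (fun x y hxy => ?_) hg₂ hf₂
    refine hf.lt_iff_lt.1 ?_
    rwa [show f (f⁻¹ x) = x from f.apply_symm_apply x,
      show f (f⁻¹ y) = y from f.apply_symm_apply y]
  inv_mem' := by
    rintro f ⟨hf, hf₁, hf₂⟩
    refine ⟨fun x y hxy => hf.lt_iff_lt.1 ?_, hf₂, by rwa [inv_inv]⟩
    rwa [show f (f⁻¹ x) = x from f.apply_symm_apply x,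
      show f (f⁻¹ y) = y from f.apply_symm_apply y]

/-- The group `H₊^AC([a, b])`. It is a type of its own, so that it carries no topology other than
the one of the metric `ρ` below. -/
def HPlusAC (a b : ℝ) : Type := hPlusACSubgroup a b

namespace HPlusAC

variable {a b : ℝ}

instance : Group (HPlusAC a b) := inferInstanceAs (Group (hPlusACSubgroup a b))

/-- The underlying homeomorphism of `[a, b]`. -/
def toHomeo (f : HPlusAC a b) : Icc a b ≃ₜ Icc a b := Subtype.val f

/-- The metric `ρ(f, g) = ∫_a^b |f' - g'|`. -/
def rho (f g : HPlusAC a b) : ℝ :=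
  ∫ x in Icc a b, |deriv (extendId f.toHomeo) x - deriv (extendId g.toHomeo) x|

lemma integrableOn_deriv (f : HPlusAC a b) :
    IntegrableOn (deriv (extendId f.toHomeo)) (Icc a b) := by
  rcases le_or_gt a b with hab | hab
  · have h := f.2.2.1.intervalIntegrable_deriv
    rwa [intervalIntegrable_iff_integrableOn_Icc_of_le hab] at h
  · rw [Icc_eq_empty hab.not_ge]; exact integrableOn_empty

lemma extendId_left (f : HPlusAC a b) : extendId f.toHomeo a = a := by
  by_cases ha : a ∈ Icc a b
  · rw [extendId_of_mem _ ha]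
    obtain ⟨z, hz⟩ := f.toHomeo.surjective ⟨a, ha⟩
    have h : f.toHomeo ⟨a, ha⟩ ≤ f.toHomeo z :=
      f.2.1.monotone (show (⟨a, ha⟩ : Icc a b) ≤ z from z.2.1)
    rw [hz] at h
    exact le_antisymm h (f.toHomeo ⟨a, ha⟩).2.1
  · exact extendId_of_notMem _ ha

lemma eq_of_rho_eq_zero {f g : HPlusAC a b} (h : rho f g = 0) : f = g := by
  have hae : ∀ᵐ x, x ∈ Icc a b →
      deriv (extendId f.toHomeo) x = deriv (extendId g.toHomeo) x := by
    have h' := (integral_eq_zero_iff_of_nonneg (fun _ => abs_nonneg _)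
      ((integrableOn_deriv f).sub (integrableOn_deriv g)).abs).1 h
    filter_upwards [(ae_restrict_iff' measurableSet_Icc).1 h'] with x hx hxm
    exact sub_eq_zero.1 (abs_eq_zero.1 (hx hxm))
  refine Subtype.ext (Homeomorph.ext fun x => Subtype.ext ?_)
  have hab : a ≤ b := x.2.1.trans x.2.2
  have hsub : uIcc a (x : ℝ) ⊆ uIcc a b := by
    rw [uIcc_of_le hab, uIcc_of_le x.2.1]; exact Icc_subset_Icc_right x.2.2
  have hf := (f.2.2.1.mono hsub).integral_deriv_eq_sub
  have hg := (g.2.2.1.mono hsub).integral_deriv_eq_sub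
  have hi : ∫ t in a..(x : ℝ), deriv (extendId f.toHomeo) t =
      ∫ t in a..(x : ℝ), deriv (extendId g.toHomeo) t := by
    refine intervalIntegral.integral_congr_ae ?_
    filter_upwards [hae] with t ht htm
    rw [uIoc_of_le x.2.1] at htm
    exact ht ⟨htm.1.le, htm.2.trans x.2.2⟩
  have hfa := extendId_left f
  have hga := extendId_left g
  have hfx : extendId f.toHomeo x = f.toHomeo x := extendId_of_mem _ x.2
  have hgx : extendId g.toHomeo x = g.toHomeo x := extendId_of_mem _ x.2
  change (f.toHomeo x : ℝ) = g.toHomeo x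
  change _ = extendId f.toHomeo x - extendId f.toHomeo a at hf
  change _ = extendId g.toHomeo x - extendId g.toHomeo a at hg
  change ∫ t in a..(x : ℝ), deriv (extendId f.toHomeo) t = _ at hf
  change ∫ t in a..(x : ℝ), deriv (extendId g.toHomeo) t = _ at hg
  linarith

/-- The topology of `H₊^AC([a, b])` is the one of the metric `ρ`. -/
instance : MetricSpace (HPlusAC a b) where
  dist := rho
  dist_self f := by simp [rho]
  dist_comm f g := by simp only [rho, abs_sub_comm]
  dist_triangle f g h := by
    have hf := integrableOn_deriv f
    have hg := integrableOn_deriv g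
    have hh := integrableOn_deriv h
    refine le_trans (integral_mono (hf.sub hh).abs ((hf.sub hg).abs.add (hg.sub hh).abs)
      fun x => abs_sub_le _ (deriv (extendId g.toHomeo) x) _)
      (integral_add (hf.sub hg).abs (hg.sub hh).abs).le
  eq_of_dist_eq_zero := eq_of_rho_eq_zero

end HPlusAC

/-- The set `Ω_n` of the `n`-tuples that generate a dense subgroup of `G`. -/
def denseGenerators (G : Type*) [Group G] [TopologicalSpace G] (n : ℕ) : Set (Fin n → G) :=
  {g | Dense (Subgroup.closure (range g) : Set G)}

/-- `G` has a dense subgroup generated by `n` elements. -/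
def IsTopologicallyGenerated (G : Type*) [Group G] [TopologicalSpace G] (n : ℕ) : Prop :=
  (denseGenerators G n).Nonempty

/-- The `n`-tuples that generate a dense subgroup form a comeagre subset of `G ^ n`. -/
def IsGenericallyGenerated (G : Type*) [Group G] [TopologicalSpace G] (n : ℕ) : Prop :=
  denseGenerators G n ∈ residual (Fin n → G)

/-- The least `n` such that `G` is topologically `n`-generated. The value `⊤` (no finite `n`)
stands for `ℵ₀`, as every Polish group is topologically `ℵ₀`-generated. -/
def topologicalRank (G : Type*) [Group G] [TopologicalSpace G] : ℕ∞ :=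
  ⨅ (n : ℕ) (_ : IsTopologicallyGenerated G n), (n : ℕ∞)

/-- The least `n` such that `G` is generically `n`-generated. The value `⊤` (no finite `n`)
stands for `ℵ₀`, as every Polish group is generically `ℵ₀`-generated. -/
def genericRank (G : Type*) [Group G] [TopologicalSpace G] : ℕ∞ :=
  ⨅ (n : ℕ) (_ : IsGenericallyGenerated G n), (n : ℕ∞)

end

open Filter

/-! The metric is the total variation of `f - g`, so monotone reparametrization does not increase it
(`dist_mul_right_le`). Left translations are continuous because `f'` is close in `L¹` to a
continuous function (`continuous_mul_left'`). Together these give a topological group. The map `f ↦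
(f', (f⁻¹)')` is a closed embedding into `L¹ × L¹`, so the group is Polish.

In a second countable topological group the dense pairs are a countable intersection of open sets,
one for each basic open set to be met by a word. By Baire it remains to perturb a given pair `(f,
g)` so that its group comes near a given `h` (`exists_near`). This takes three moves. Common fixed
points in `(a, b)` are removed by a dimension count: a `C¹` curve cannot fill an open set of the
plane (`exists_no_common_fixed_near`). Next, one generator is changed near `a` to have no fixed
point there (`exists_near_of_fn_ne`). Some `x` in the group then has an inverse that squeezes almost
all of `(a, b)` into a tiny neighbourhood of `a`. Finally `g` is redefined in that neighbourhood to
be `x⁻¹ h x`, a small change in the metric since little mass lies there. Conjugating back by `x`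
recovers `h` away from the end points (`exists_near_of_no_common_fixed`). The word `x` itself
involves `g`, but only values outside the altered region matter (`exists_eqOn_of_mem_closure`).

One generator is not enough, since a Hausdorff group with a dense cyclic subgroup is commutative and
this group is not. -/

/-! ### Absolutely continuous functions: composition and gluing -/

/-- Absolute continuity on `[a, b]` only depends on the values on `[a, b]`. -/
lemma AbsolutelyContinuousOnInterval.congr_of_eqOn {u v : ℝ → ℝ} {a b : ℝ}
    (hu : AbsolutelyContinuousOnInterval u a b) (h : EqOn u v (uIcc a b)) :
    AbsolutelyContinuousOnInterval v a b := by
  rw [absolutelyContinuousOnInterval_iff] at hu ⊢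
  intro ε hε
  obtain ⟨δ, hδ, h₁⟩ := hu ε hε
  refine ⟨δ, hδ, fun E hE hlen => ?_⟩
  refine lt_of_eq_of_lt (Finset.sum_congr rfl fun i hi => ?_) (h₁ E hE hlen)
  rw [h (hE.1 i hi).1, h (hE.1 i hi).2]

/-- An absolutely continuous function composed with a monotone absolutely continuous function is
absolutely continuous. -/
lemma AbsolutelyContinuousOnInterval.comp_monotone {u θ : ℝ → ℝ} {a b c d : ℝ}
    (hu : AbsolutelyContinuousOnInterval u c d) (hθ : AbsolutelyContinuousOnInterval θ a b)
    (hm : Monotone θ) (hmaps : MapsTo θ (uIcc a b) (uIcc c d)) :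
    AbsolutelyContinuousOnInterval (u ∘ θ) a b := by
  rw [absolutelyContinuousOnInterval_iff] at hu hθ ⊢
  intro ε hε
  obtain ⟨δ₁, hδ₁, h₁⟩ := hu ε hε
  obtain ⟨δ, hδ, h₂⟩ := hθ δ₁ hδ₁
  refine ⟨δ, hδ, fun E hE hlen => ?_⟩
  refine h₁ (E.1, fun i => (θ (E.2 i).1, θ (E.2 i).2)) ⟨?_, ?_⟩ (h₂ E hE hlen)
  · intro i hi
    exact ⟨hmaps (hE.1 i hi).1, hmaps (hE.1 i hi).2⟩
  · intro i hi j hj hij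
    have h := hE.2 hi hj hij
    simp only [Function.onFun, uIoc, Ioc_disjoint_Ioc] at h ⊢
    simp only [← hm.map_min, ← hm.map_max]
    exact hm h

/-- Two absolutely continuous functions that agree at `p` may be glued there. -/
lemma AbsolutelyContinuousOnInterval.glue {u v : ℝ → ℝ} {a b p : ℝ} (hap : a ≤ p) (hpb : p ≤ b)
    (hu : AbsolutelyContinuousOnInterval u a b) (hv : AbsolutelyContinuousOnInterval v a b)
    (huv : u p = v p) :
    AbsolutelyContinuousOnInterval (fun x => if x ≤ p then u x else v x) a b := by
  have hab := hap.trans hpb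
  -- The glued function is `u (min x p) + v (max x p) - u p`, and `min` and `max` with `p` are
  -- monotone and Lipschitz.
  have h1 : AbsolutelyContinuousOnInterval (fun x : ℝ => min x p) a b :=
    (LipschitzWith.id.min_const p).lipschitzOnWith.absolutelyContinuousOnInterval
  have h2 : AbsolutelyContinuousOnInterval (fun x : ℝ => max x p) a b :=
    (LipschitzWith.id.max_const p).lipschitzOnWith.absolutelyContinuousOnInterval
  have h3 := hu.comp_monotone h1 (fun x y h => min_le_min_right p h) (by
    rw [uIcc_of_le hab]; exact fun x hx => ⟨le_min hx.1 hap, (min_le_left _ _).trans hx.2⟩)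
  have h4 := hv.comp_monotone h2 (fun x y h => max_le_max_right p h) (by
    rw [uIcc_of_le hab]; exact fun x hx => ⟨hx.1.trans (le_max_left _ _), max_le hx.2 hpb⟩)
  have h5 : AbsolutelyContinuousOnInterval (fun _ : ℝ => u p) a b :=
    (LipschitzWith.const (u p)).lipschitzOnWith.absolutelyContinuousOnInterval
  refine ((h3.add h4).sub h5).congr_of_eqOn fun x _ => ?_
  simp only [Pi.sub_apply, Pi.add_apply, Function.comp]
  split_ifs with h
  · rw [min_eq_left h, max_eq_right h, huv]; ring
  · rw [min_eq_right (not_le.1 h).le, max_eq_left (not_le.1 h).le]; ring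

/-! ### Total variation and reparametrization -/

/-- If the increments of `v` are dominated by those of `P`, then `|v'| ≤ P'`. -/
lemma abs_deriv_le_deriv_of_dominated {v P : ℝ → ℝ} {s : Set ℝ} {x : ℝ} (hs : s ∈ 𝓝 x)
    (hP : DifferentiableAt ℝ P x)
    (h : ∀ y ∈ s, ∀ z ∈ s, y ≤ z → |v z - v y| ≤ P z - P y) : |deriv v x| ≤ deriv P x := by
  have hxs := mem_of_mem_nhds hs
  have key : ∀ y ∈ s, |slope v x y| ≤ slope P x y := by
    intro y hy
    rw [slope_def_field, slope_def_field]
    rcases lt_trichotomy x y with hxy | rfl | hxy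
    · rw [abs_div, abs_of_pos (sub_pos.2 hxy)]
      exact div_le_div_of_nonneg_right (h x hxs y hy hxy.le) (sub_pos.2 hxy).le
    · simp
    · rw [abs_div, abs_of_neg (sub_neg.2 hxy), abs_sub_comm, ← neg_sub (P x), neg_div,
        ← div_neg]
      exact div_le_div_of_nonneg_right (h y hy x hxs hxy.le) (by linarith)
  have hP' := hasDerivAt_iff_tendsto_slope.1 hP.hasDerivAt
  have hev : ∀ᶠ y in 𝓝[≠] x, y ∈ s := mem_nhdsWithin_of_mem_nhds hs
  by_cases hv : DifferentiableAt ℝ v x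
  · exact le_of_tendsto_of_tendsto (hasDerivAt_iff_tendsto_slope.1 hv.hasDerivAt).abs hP'
      (hev.mono fun y hy => key y hy)
  -- Here `deriv v x` is the default value `0`, so only the sign of the slopes of `P` matters.
  · rw [deriv_zero_of_not_differentiableAt hv, abs_zero]
    exact ge_of_tendsto hP' (hev.mono fun y hy => (abs_nonneg _).trans (key y hy))

/-- If the increments of `v` are dominated by those of `P`, then `∫ |v'| ≤ P b - P a`. -/
lemma integral_abs_deriv_le_of_dominated {v P : ℝ → ℝ} {a b : ℝ} (hab : a ≤ b)
    (h : ∀ x ∈ Icc a b, ∀ y ∈ Icc a b, x ≤ y → |v y - v x| ≤ P y - P x) :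
    ∫ x in Icc a b, |deriv v x| ≤ P b - P a := by
  have hP : MonotoneOn P (uIcc a b) := by
    rw [uIcc_of_le hab]
    intro x hx y hy hxy
    linarith [(abs_nonneg _).trans (h x hx y hy hxy)]
  -- Lebesgue's inequality for a monotone `P`, which needs no absolute continuity.
  have h1 := hP.intervalIntegral_deriv_mem_uIcc
  have hle : 0 ≤ P b - P a := (abs_nonneg _).trans
    (h a (left_mem_Icc.2 hab) b (right_mem_Icc.2 hab) hab)
  rw [uIcc_of_le hle, intervalIntegral.integral_of_le hab, ← integral_Icc_eq_integral_Ioc] at h1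
  refine le_trans (integral_mono_of_nonneg (ae_of_all _ fun _ => abs_nonneg _) ?_ ?_) h1.2
  · exact (intervalIntegrable_iff_integrableOn_Icc_of_le hab).1 hP.intervalIntegrable_deriv
  · have h2 : ∀ᵐ x, x ∈ Icc a b → DifferentiableWithinAt ℝ P (Icc a b) x := by
      rw [uIcc_of_le hab] at hP
      exact hP.ae_differentiableWithinAt_of_mem
    have ha : ∀ᵐ x : ℝ, x ≠ a := by simp [ae_iff, measure_singleton]
    have hb : ∀ᵐ x : ℝ, x ≠ b := by simp [ae_iff, measure_singleton]
    rw [EventuallyLE, ae_restrict_iff' measurableSet_Icc]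
    filter_upwards [h2, ha, hb] with x hx hxa hxb hmem
    have hs : Icc a b ∈ 𝓝 x := Icc_mem_nhds (lt_of_le_of_ne hmem.1 hxa.symm)
      (lt_of_le_of_ne hmem.2 hxb)
    exact abs_deriv_le_deriv_of_dominated hs ((hx hmem).differentiableAt hs) h

/-- The increments of an absolutely continuous function are bounded by the integral of the absolute
value of its derivative. -/
lemma AbsolutelyContinuousOnInterval.abs_sub_le_integral {k : ℝ → ℝ} {a b x y : ℝ}
    (hk : AbsolutelyContinuousOnInterval k a b) (hx : x ∈ Icc a b) (hy : y ∈ Icc a b)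
    (hxy : x ≤ y) : |k y - k x| ≤ ∫ t in x..y, |deriv k t| := by
  have hsub : uIcc x y ⊆ uIcc a b := by
    rw [uIcc_of_le hxy, uIcc_of_le (hx.1.trans hx.2)]; exact Icc_subset_Icc hx.1 hy.2
  rw [← (hk.mono hsub).integral_deriv_eq_sub]
  exact intervalIntegral.abs_integral_le_integral_abs hxy

/-- The derivative of an absolutely continuous function is integrable. -/
lemma AbsolutelyContinuousOnInterval.integrableOn_deriv {k : ℝ → ℝ} {a b : ℝ} (hab : a ≤ b)
    (hk : AbsolutelyContinuousOnInterval k a b) : IntegrableOn (deriv k) (Icc a b) :=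
  (intervalIntegrable_iff_integrableOn_Icc_of_le hab).1 hk.intervalIntegrable_deriv

/-- A monotone reparametrization does not increase the total variation. -/
lemma AbsolutelyContinuousOnInterval.integral_abs_deriv_comp_le {k θ : ℝ → ℝ} {a b : ℝ}
    (hab : a ≤ b) (hk : AbsolutelyContinuousOnInterval k a b) (hm : MonotoneOn θ (Icc a b))
    (hmaps : MapsTo θ (Icc a b) (Icc a b)) :
    ∫ x in Icc a b, |deriv (k ∘ θ) x| ≤ ∫ x in Icc a b, |deriv k x| := by
  have hint : ∀ x ∈ Icc a b, ∀ y ∈ Icc a b,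
      IntervalIntegrable (fun t => |deriv k t|) volume x y := by
    intro x hx y hy
    refine hk.intervalIntegrable_deriv.abs.mono_set ?_
    rw [uIcc_of_le hab]
    exact uIcc_subset_Icc hx hy
  have hl := left_mem_Icc.2 hab
  have hr := right_mem_Icc.2 hab
  have hnn : ∀ x y : ℝ, x ≤ y → 0 ≤ ∫ t in x..y, |deriv k t| := fun x y h =>
    intervalIntegral.integral_nonneg h fun _ _ => abs_nonneg _
  -- The variation of `k` up to `θ x` dominates the increments of `k ∘ θ`. This avoids the chain
  -- rule, and `θ` need only be monotone.
  have key := integral_abs_deriv_le_of_dominated (v := k ∘ θ)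
    (P := fun x => ∫ t in a..θ x, |deriv k t|) hab (by
      intro x hx y hy hxy
      have h1 := hk.abs_sub_le_integral (hmaps hx) (hmaps hy) (hm hx hy hxy)
      have h2 := intervalIntegral.integral_add_adjacent_intervals (hint a hl _ (hmaps hx))
        (hint _ (hmaps hx) _ (hmaps hy))
      simp only [Function.comp]
      linarith)
  refine key.trans ?_
  have h1 := intervalIntegral.integral_add_adjacent_intervals (hint a hl _ (hmaps hr))
        (hint _ (hmaps hr) _ hr)
  have h2 := hnn _ _ (hmaps hl).1
  have h3 := hnn _ _ (hmaps hr).2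
  rw [integral_Icc_eq_integral_Ioc, ← intervalIntegral.integral_of_le hab]
  linarith

/-! ### Continuous approximation in `L¹` and primitives -/

/-- An integrable function on `[a, b]` is approximated in `L¹` by a continuous function with compact
support. -/
lemma MeasureTheory.IntegrableOn.exists_continuous_approx {u : ℝ → ℝ} {a b : ℝ}
    (hu : IntegrableOn u (Icc a b)) {ε : ℝ} (hε : 0 < ε) :
    ∃ φ : ℝ → ℝ, Continuous φ ∧ HasCompactSupport φ ∧ ∫ x in Icc a b, |u x - φ x| ≤ ε := by
  obtain ⟨φ, hsupp, hle, hc, hi⟩ :=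
    (hu.integrable_indicator measurableSet_Icc).exists_hasCompactSupport_integral_sub_le hε
  refine ⟨φ, hc, hsupp, le_trans ?_ hle⟩
  have h1 := setIntegral_le_integral (s := Icc a b)
    ((hu.integrable_indicator measurableSet_Icc).sub hi).norm (ae_of_all _ fun _ => norm_nonneg _)
  refine le_trans (le_of_eq ?_) h1
  refine setIntegral_congr_fun measurableSet_Icc fun x hx => ?_
  simp [indicator_of_mem hx, Real.norm_eq_abs]

lemma Continuous.hasDerivAt_const_add_integral {φ : ℝ → ℝ} (hφ : Continuous φ) (c a x : ℝ) :
    HasDerivAt (fun x => c + ∫ t in a..x, φ t) (φ x) x :=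
  (intervalIntegral.integral_hasDerivAt_right (hφ.intervalIntegrable _ _)
    (hφ.stronglyMeasurableAtFilter _ _) hφ.continuousAt).const_add c

lemma Continuous.contDiff_const_add_integral {φ : ℝ → ℝ} (hφ : Continuous φ) (c a : ℝ) :
    ContDiff ℝ 1 (fun x => c + ∫ t in a..x, φ t) := by
  rw [contDiff_one_iff_deriv]
  refine ⟨fun x => (hφ.hasDerivAt_const_add_integral c a x).differentiableAt, ?_⟩
  rwa [funext fun x => (hφ.hasDerivAt_const_add_integral c a x).deriv]

/-! ### Group elements as functions on the line -/

namespace HPlusAC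

variable {a b : ℝ}

/-- The self-map of `ℝ` that extends `f` by the identity. -/
noncomputable abbrev fn (f : HPlusAC a b) : ℝ → ℝ := extendId f.toHomeo

lemma fn_mul (f g : HPlusAC a b) (x : ℝ) : (f * g).fn x = f.fn (g.fn x) :=
  congrFun (extendId_mul f.toHomeo g.toHomeo) x

lemma fn_one (x : ℝ) : (1 : HPlusAC a b).fn x = x := congrFun extendId_one x

lemma fn_inv_fn (f : HPlusAC a b) (x : ℝ) : f⁻¹.fn (f.fn x) = x := by
  rw [← fn_mul, inv_mul_cancel, fn_one]

lemma fn_fn_inv (f : HPlusAC a b) (x : ℝ) : f.fn (f⁻¹.fn x) = x := by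
  rw [← fn_mul, mul_inv_cancel, fn_one]

lemma fn_strictMono (f : HPlusAC a b) : StrictMono f.fn :=
  (extendId_monotone f.2.1).strictMono_of_injective (Function.LeftInverse.injective f.fn_inv_fn)

lemma fn_left (f : HPlusAC a b) : f.fn a = a := extendId_left f

lemma fn_right (f : HPlusAC a b) : f.fn b = b := by
  by_cases hb : b ∈ Icc a b
  · have h1 : f⁻¹.fn b ≤ b := by
      rw [fn, extendId_of_mem _ hb]; exact (f⁻¹.toHomeo ⟨b, hb⟩).2.2
    have h2 : f.fn b ≤ b := by
      rw [fn, extendId_of_mem _ hb]; exact (f.toHomeo ⟨b, hb⟩).2.2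
    have h3 := f.fn_strictMono.monotone h1
    rw [fn_fn_inv] at h3
    exact le_antisymm h2 h3
  · exact extendId_of_notMem _ hb

lemma fn_mem_Icc (f : HPlusAC a b) {x : ℝ} (hx : x ∈ Icc a b) : f.fn x ∈ Icc a b := by
  rw [fn, extendId_of_mem _ hx]; exact (f.toHomeo ⟨x, hx⟩).2

lemma fn_mem_Ioo (f : HPlusAC a b) {x : ℝ} (hx : x ∈ Ioo a b) : f.fn x ∈ Ioo a b := by
  constructor
  · simpa only [fn_left] using f.fn_strictMono hx.1
  · simpa only [fn_right] using f.fn_strictMono hx.2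

lemma fn_absolutelyContinuous (f : HPlusAC a b) :
    AbsolutelyContinuousOnInterval f.fn a b := f.2.2.1

lemma fn_inv_eq {f : HPlusAC a b} {x y : ℝ} (h : f.fn x = y) : f⁻¹.fn y = x := by
  rw [← h, fn_inv_fn]

lemma fn_inv_lt_iff {f : HPlusAC a b} {x y : ℝ} : f⁻¹.fn x < y ↔ x < f.fn y := by
  rw [← f.fn_strictMono.lt_iff_lt, fn_fn_inv]

lemma eq_of_fn_eqOn {f g : HPlusAC a b} (h : EqOn f.fn g.fn (Icc a b)) : f = g := by
  refine Subtype.ext (Homeomorph.ext fun x => Subtype.ext ?_)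
  have := h x.2
  rwa [fn, fn, extendId_of_mem _ x.2, extendId_of_mem _ x.2] at this

/-! ### Constructing elements of the group -/

/-- Two mutually inverse absolutely continuous increasing functions give an element of the
group. -/
lemma exists_of_inverse {u v : ℝ → ℝ} (hu : AbsolutelyContinuousOnInterval u a b)
    (hv : AbsolutelyContinuousOnInterval v a b) (hum : MapsTo u (Icc a b) (Icc a b))
    (hvm : MapsTo v (Icc a b) (Icc a b)) (hmono : MonotoneOn u (Icc a b))
    (hvu : LeftInvOn v u (Icc a b)) (huv : LeftInvOn u v (Icc a b)) :
    ∃ f : HPlusAC a b, EqOn f.fn u (Icc a b) ∧ EqOn f⁻¹.fn v (Icc a b) := by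
  have hsm : StrictMonoOn u (Icc a b) := hmono.strictMonoOn_iff_injOn.2 hvu.injOn
  let e : Icc a b ≃ Icc a b :=
    { toFun := fun x => ⟨u x, hum x.2⟩
      invFun := fun x => ⟨v x, hvm x.2⟩
      left_inv := fun x => Subtype.ext (hvu x.2)
      right_inv := fun x => Subtype.ext (huv x.2) }
  have he : StrictMono e := fun x y h => hsm x.2 y.2 h
  let o : Icc a b ≃o Icc a b := StrictMono.orderIsoOfSurjective e he e.surjective
  have hoe : ∀ x, o x = e x := fun x => rfl
  let F : Icc a b ≃ₜ Icc a b := o.toHomeomorph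
  have hFe : ∀ x, F x = e x := fun x => rfl
  have hFi : ∀ x, F⁻¹ x = e.symm x := fun x => by
    rw [Equiv.eq_symm_apply, ← hFe]
    exact F.apply_symm_apply x
  have h1 : EqOn (extendId F) u (Icc a b) := fun x hx => by
    rw [extendId_of_mem _ hx, hFe]; rfl
  have h2 : EqOn (extendId F⁻¹) v (Icc a b) := fun x hx => by
    rw [extendId_of_mem _ hx, hFi]; rfl
  rcases le_or_gt a b with hab | hab
  · refine ⟨⟨F, he, ?_, ?_⟩, h1, h2⟩
    · exact hu.congr_of_eqOn (by rw [uIcc_of_le hab]; exact h1.symm)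
    · exact hv.congr_of_eqOn (by rw [uIcc_of_le hab]; exact h2.symm)
  · refine ⟨1, ?_, ?_⟩ <;> simp [Icc_eq_empty hab.not_ge]

/-- Elements of the group that agree at a point can be glued there. -/
lemma exists_glue (f g : HPlusAC a b) {p : ℝ} (hp : p ∈ Icc a b) (h : f.fn p = g.fn p) :
    ∃ k : HPlusAC a b, (∀ x ∈ Icc a b, x ≤ p → k.fn x = f.fn x) ∧
      ∀ x ∈ Icc a b, p ≤ x → k.fn x = g.fn x := by
  obtain ⟨q, hq⟩ : ∃ q, q = f.fn p := ⟨_, rfl⟩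
  have hq' : q ∈ Icc a b := hq ▸ f.fn_mem_Icc hp
  have hfq : f⁻¹.fn q = p := fn_inv_eq hq.symm
  have hgq : g⁻¹.fn q = p := fn_inv_eq (h ▸ hq.symm)
  have hf : ∀ x, f.fn x ≤ q ↔ x ≤ p := fun x => by rw [hq, f.fn_strictMono.le_iff_le]
  have hg : ∀ x, g.fn x ≤ q ↔ x ≤ p := fun x => by rw [hq, h, g.fn_strictMono.le_iff_le]
  have hf' : ∀ x, f⁻¹.fn x ≤ p ↔ x ≤ q := fun x => by rw [← hf, fn_fn_inv]
  have hg' : ∀ x, g⁻¹.fn x ≤ p ↔ x ≤ q := fun x => by rw [← hg, fn_fn_inv]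
  obtain ⟨k, hk, -⟩ := exists_of_inverse (a := a) (b := b)
    (u := fun x => if x ≤ p then f.fn x else g.fn x)
    (v := fun x => if x ≤ q then f⁻¹.fn x else g⁻¹.fn x)
    (f.fn_absolutelyContinuous.glue hp.1 hp.2 g.fn_absolutelyContinuous h)
    (f⁻¹.fn_absolutelyContinuous.glue hq'.1 hq'.2 g⁻¹.fn_absolutelyContinuous
      (hfq.trans hgq.symm))
    (fun x hx => by
      dsimp only
      split_ifs
      exacts [f.fn_mem_Icc hx, g.fn_mem_Icc hx])
    (fun x hx => by
      dsimp only
      split_ifs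
      exacts [f⁻¹.fn_mem_Icc hx, g⁻¹.fn_mem_Icc hx])
    (fun x _ y _ hxy => by
      dsimp only
      split_ifs with h1 h2 h2
      · exact f.fn_strictMono.monotone hxy
      · exact ((hf x).2 h1).trans (not_le.1 (mt (hg y).1 h2)).le
      · exact absurd (hxy.trans h2) h1
      · exact g.fn_strictMono.monotone hxy)
    (fun x _ => by
      dsimp only
      by_cases h1 : x ≤ p
      · rw [if_pos h1, if_pos ((hf x).2 h1), fn_inv_fn]
      · rw [if_neg h1, if_neg (mt (hg x).1 h1), fn_inv_fn])
    (fun x _ => by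
      dsimp only
      by_cases h1 : x ≤ q
      · rw [if_pos h1, if_pos ((hf' x).2 h1), fn_fn_inv]
      · rw [if_neg h1, if_neg (mt (hg' x).1 h1), fn_fn_inv])
  refine ⟨k, fun x hx hxp => ?_, fun x hx hpx => ?_⟩
  · rw [hk hx]; exact if_pos hxp
  · rw [hk hx]
    rcases hpx.eq_or_lt with rfl | h1
    · rw [← h]; exact if_pos le_rfl
    · exact if_neg (not_le.2 h1)

/-- A bi-Lipschitz increasing function gives an element of the group. -/
lemma exists_of_biLipschitz {u : ℝ → ℝ} {m M : ℝ} (hab : a ≤ b) (hm : 0 < m) (hua : u a = a)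
    (hub : u b = b)
    (hu : ∀ x ∈ Icc a b, ∀ y ∈ Icc a b, x ≤ y →
      m * (y - x) ≤ u y - u x ∧ u y - u x ≤ M * (y - x)) :
    ∃ f : HPlusAC a b, EqOn f.fn u (Icc a b) := by
  have hmono : MonotoneOn u (Icc a b) := fun x hx y hy hxy => by
    nlinarith [(hu x hx y hy hxy).1]
  have hlip : LipschitzOnWith (Real.toNNReal M) u (Icc a b) := by
    refine LipschitzOnWith.of_le_add_mul _ fun x hx y hy => ?_
    rcases le_total x y with h | h
    · have := hmono hx hy h
      have : 0 ≤ (Real.toNNReal M : ℝ) * dist x y := by positivity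
      linarith
    · rw [Real.dist_eq, abs_of_nonneg (sub_nonneg.2 h)]
      have := (hu y hy x hx h).2
      have := mul_le_mul_of_nonneg_right (Real.le_coe_toNNReal M) (sub_nonneg.2 h)
      linarith
  have hl := left_mem_Icc.2 hab
  have hr := right_mem_Icc.2 hab
  have hmaps : MapsTo u (Icc a b) (Icc a b) := fun x hx =>
    ⟨hua ▸ hmono hl hx hx.1, hub ▸ hmono hx hr hx.2⟩
  have hsurj : ∀ y, ∃ x, y ∈ Icc a b → x ∈ Icc a b ∧ u x = y := fun y => by
    by_cases hy : y ∈ Icc a b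
    · obtain ⟨x, hx, hxy⟩ := intermediate_value_Icc hab hlip.continuousOn
        (show y ∈ Icc (u a) (u b) by rwa [hua, hub])
      exact ⟨x, fun _ => ⟨hx, hxy⟩⟩
    · exact ⟨y, fun h => absurd h hy⟩
  choose v hv using hsurj
  have hinj : InjOn u (Icc a b) := by
    intro x hx y hy hxy
    rcases le_total x y with h | h
    · nlinarith [(hu x hx y hy h).1]
    · nlinarith [(hu y hy x hx h).1]
  -- The lower bound `m` on the slopes of `u` becomes the Lipschitz constant `m⁻¹` of the inverse.
  have hvlip : LipschitzOnWith (Real.toNNReal m⁻¹) v (Icc a b) := by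
    refine LipschitzOnWith.of_le_add_mul _ fun x hx y hy => ?_
    rw [Real.coe_toNNReal _ (inv_pos.2 hm).le]
    rcases le_total (v x) (v y) with h | h
    · have : 0 ≤ m⁻¹ * dist x y := by positivity
      linarith
    · have h1 := (hu _ (hv y hy).1 _ (hv x hx).1 h).1
      rw [(hv x hx).2, (hv y hy).2] at h1
      have h2 : v x - v y ≤ m⁻¹ * (x - y) := by
        rw [inv_mul_eq_div, le_div_iff₀ hm]; linarith
      have h3 := mul_le_mul_of_nonneg_left (le_abs_self (x - y)) (inv_pos.2 hm).le
      rw [Real.dist_eq]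
      linarith
  rw [← uIcc_of_le hab] at hlip hvlip
  obtain ⟨f, hf, -⟩ := exists_of_inverse hlip.absolutelyContinuousOnInterval
    hvlip.absolutelyContinuousOnInterval hmaps (fun y hy => (hv y hy).1) hmono
    (fun x hx => hinj (hv _ (hmaps hx)).1 hx (hv _ (hmaps hx)).2) (fun y hy => (hv y hy).2)
  exact ⟨f, hf⟩

/-- A `C¹` function with positive derivative that fixes the end points gives an element of the
group. -/
lemma exists_of_contDiff {F : ℝ → ℝ} {m : ℝ} (hab : a ≤ b) (hm : 0 < m) (hF : ContDiff ℝ 1 F)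
    (hFa : F a = a) (hFb : F b = b) (hd : ∀ x ∈ Icc a b, m ≤ deriv F x) :
    ∃ f : HPlusAC a b, EqOn f.fn F (Icc a b) := by
  obtain ⟨M, hM⟩ := isCompact_Icc.exists_bound_of_continuousOn (s := Icc a b)
    (hF.continuous_deriv le_rfl).continuousOn
  have hdiff := hF.differentiable one_ne_zero
  refine exists_of_biLipschitz (M := M) hab hm hFa hFb fun x hx y hy hxy => ⟨?_, ?_⟩
  · exact (convex_Icc a b).mul_sub_le_image_sub_of_le_deriv hdiff.continuous.continuousOn
      hdiff.differentiableOn (fun z hz => hd z (interior_subset hz)) x hx y hy hxy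
  · exact (convex_Icc a b).image_sub_le_mul_sub_of_deriv_le hdiff.continuous.continuousOn
      hdiff.differentiableOn
      (fun z hz => (le_abs_self _).trans (hM z (interior_subset hz))) x hx y hy hxy

/-! ### Elements with prescribed values -/

/-- An element that is the identity on `[a, l]`, maps `p` to `q > p` and has no fixed point in
`(l, b)`. -/
lemma exists_move_up {l p q : ℝ} (hal : a ≤ l) (hlp : l < p) (hpq : p < q) (hqb : q < b) :
    ∃ f : HPlusAC a b, (∀ x ∈ Icc a l, f.fn x = x) ∧ f.fn p = q ∧
      ∀ x ∈ Ioo l b, x < f.fn x := by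
  set s := (q - l) / (p - l) with hs
  set t := (b - q) / (b - p) with ht
  have hpl : 0 < p - l := by linarith
  have hbp : 0 < b - p := by linarith
  have hs1 : 1 < s := by rw [hs, one_lt_div hpl]; linarith
  have ht0 : 0 < t := div_pos (by linarith) hbp
  have ht1 : t < 1 := by rw [ht, div_lt_one hbp]; linarith
  have hsp : l + s * (p - l) = q := by rw [hs]; field_simp; ring
  have htp : b - t * (b - p) = q := by rw [ht]; field_simp; ring
  have hlin : ∀ c x y : ℝ, c ∈ Icc t s → x ≤ y → t * (y - x) ≤ c * (y - x) ∧
      c * (y - x) ≤ s * (y - x) := fun c x y hc hxy =>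
    ⟨mul_le_mul_of_nonneg_right hc.1 (sub_nonneg.2 hxy),
      mul_le_mul_of_nonneg_right hc.2 (sub_nonneg.2 hxy)⟩
  -- The line of slope `s > 1` joins `(l, l)` to `(p, q)`, and that of slope `t < 1` joins `(p, q)`
  -- to `(b, b)`. Their minimum is a tent above the diagonal on `(l, b)`, and the maximum with `x`
  -- restores the identity left of `l`. All slopes lie in `[t, s]`.
  obtain ⟨f, hf⟩ := exists_of_biLipschitz (a := a) (b := b) (m := t) (M := s)
    (u := fun x => max x (min (l + s * (x - l)) (b - t * (b - x)))) (by linarith) ht0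
    (by
      refine max_eq_left ((min_le_left _ _).trans ?_)
      nlinarith)
    (by
      have : b ≤ l + s * (b - l) := by nlinarith
      simp [this])
    (fun x _ y _ hxy => by
      have h1 := hlin 1 x y ⟨ht1.le, hs1.le⟩ hxy
      have h2 := hlin s x y ⟨(ht1.trans hs1).le, le_rfl⟩ hxy
      have h3 := hlin t x y ⟨le_rfl, (ht1.trans hs1).le⟩ hxy
      constructor
      · rcases max_choice x (min (l + s * (x - l)) (b - t * (b - x))) with h | h
        · rw [h]
          linarith [le_max_left y (min (l + s * (y - l)) (b - t * (b - y)))]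
        · rw [h]
          rcases min_choice (l + s * (y - l)) (b - t * (b - y)) with h' | h'
          · have := le_max_right y (min (l + s * (y - l)) (b - t * (b - y)))
            rw [h'] at this ⊢
            linarith [min_le_left (l + s * (x - l)) (b - t * (b - x))]
          · have := le_max_right y (min (l + s * (y - l)) (b - t * (b - y)))
            rw [h'] at this ⊢
            linarith [min_le_right (l + s * (x - l)) (b - t * (b - x))]
      · rcases max_choice y (min (l + s * (y - l)) (b - t * (b - y))) with h | h
        · rw [h]
          linarith [le_max_left x (min (l + s * (x - l)) (b - t * (b - x)))]
        · rw [h]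
          rcases min_choice (l + s * (x - l)) (b - t * (b - x)) with h' | h'
          · have := le_max_right x (min (l + s * (x - l)) (b - t * (b - x)))
            rw [h'] at this ⊢
            linarith [min_le_left (l + s * (y - l)) (b - t * (b - y))]
          · have := le_max_right x (min (l + s * (x - l)) (b - t * (b - x)))
            rw [h'] at this ⊢
            linarith [min_le_right (l + s * (y - l)) (b - t * (b - y))])
  refine ⟨f, fun x hx => ?_, ?_, fun x hx => ?_⟩
  · rw [hf ⟨hx.1, by linarith [hx.2]⟩]
    refine max_eq_left ((min_le_left _ _).trans ?_)
    nlinarith [hx.2]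
  · rw [hf ⟨by linarith, by linarith⟩]
    simp only [hsp, htp, min_self]
    exact max_eq_right hpq.le
  · rw [hf ⟨by linarith [hx.1], hx.2.le⟩]
    refine lt_max_of_lt_right (lt_min ?_ ?_)
    · nlinarith [hx.1]
    · nlinarith [hx.2]

/-- An element that is the identity on `[a, l]`, maps `p` to `q` and moves the points of `(l, b)` in
the same direction as `p`. -/
lemma exists_move {l p q : ℝ} (hal : a ≤ l) (hlp : l < p) (hpb : p < b) (hlq : l < q)
    (hqb : q < b) :
    ∃ f : HPlusAC a b, (∀ x ∈ Icc a l, f.fn x = x) ∧ f.fn p = q ∧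
      (p < q → ∀ x ∈ Ioo l b, x < f.fn x) ∧ (q < p → ∀ x ∈ Ioo l b, f.fn x < x) := by
  rcases lt_trichotomy p q with h | rfl | h
  · obtain ⟨f, h1, h2, h3⟩ := exists_move_up (a := a) hal hlp h hqb
    exact ⟨f, h1, h2, fun _ => h3, fun h' => absurd h h'.not_gt⟩
  · exact ⟨1, fun x _ => fn_one x, fn_one p, fun h => absurd h (lt_irrefl _),
      fun h => absurd h (lt_irrefl _)⟩
  · obtain ⟨f, h1, h2, h3⟩ := exists_move_up (a := a) hal hlq h hpb
    refine ⟨f⁻¹, fun x hx => fn_inv_eq (h1 x hx), fn_inv_eq h2, fun h' => absurd h h'.not_gt,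
      fun _ x hx => fn_inv_lt_iff.2 (h3 x hx)⟩

/-- An element that maps `x₁ < x₂` to `y₁ < y₂`. -/
lemma exists_interpolate {x₁ x₂ y₁ y₂ : ℝ} (hx₁ : a < x₁) (hx : x₁ < x₂) (hx₂ : x₂ < b)
    (hy₁ : a < y₁) (hy : y₁ < y₂) (hy₂ : y₂ < b) :
    ∃ f : HPlusAC a b, f.fn x₁ = y₁ ∧ f.fn x₂ = y₂ := by
  obtain ⟨g, -, hg, -, -⟩ := exists_move (b := b) le_rfl hx₁ (hx.trans hx₂) hy₁ (hy.trans hy₂)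
  have h1 : y₁ < g.fn x₂ := hg ▸ g.fn_strictMono hx
  obtain ⟨k, hk, hk', -, -⟩ := exists_move (b := b) hy₁.le h1
    (g.fn_mem_Ioo ⟨hx₁.trans hx, hx₂⟩).2 hy hy₂
  exact ⟨k * g, by rw [fn_mul, hg, hk y₁ ⟨hy₁.le, le_rfl⟩], by rw [fn_mul, hk']⟩

/-! ### The metric -/

lemma dist_def (f g : HPlusAC a b) : dist f g = ∫ x in Icc a b, |deriv f.fn x - deriv g.fn x| := rfl

lemma deriv_fn_nonneg (f : HPlusAC a b) (x : ℝ) : 0 ≤ deriv f.fn x :=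
  f.fn_strictMono.monotone.deriv_nonneg

lemma intervalIntegrable_deriv_fn (f : HPlusAC a b) {x y : ℝ} (hx : x ∈ Icc a b)
    (hy : y ∈ Icc a b) : IntervalIntegrable (deriv f.fn) volume x y := by
  refine f.fn_absolutelyContinuous.intervalIntegrable_deriv.mono_set ?_
  rw [uIcc_of_le (hx.1.trans hx.2)]
  exact uIcc_subset_Icc hx hy

lemma integral_deriv_fn (f : HPlusAC a b) {x y : ℝ} (hx : x ∈ Icc a b) (hy : y ∈ Icc a b) :
    ∫ t in x..y, deriv f.fn t = f.fn y - f.fn x :=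
  (f.fn_absolutelyContinuous.mono (by
    rw [uIcc_of_le (hx.1.trans hx.2)]
    exact uIcc_subset_Icc hx hy)).integral_deriv_eq_sub

lemma integral_Icc_deriv_fn (f : HPlusAC a b) (hab : a ≤ b) :
    ∫ t in Icc a b, deriv f.fn t = b - a := by
  rw [integral_Icc_eq_integral_Ioc, ← intervalIntegral.integral_of_le hab,
    f.integral_deriv_fn (left_mem_Icc.2 hab) (right_mem_Icc.2 hab), fn_left, fn_right]

lemma ae_differentiableAt_fn (f : HPlusAC a b) :
    ∀ᵐ x, DifferentiableAt ℝ f.fn x := f.fn_strictMono.monotone.ae_differentiableAt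

/-- The metric of the group dominates the uniform one. -/
lemma abs_fn_sub_le_dist (f g : HPlusAC a b) (x : ℝ) : |f.fn x - g.fn x| ≤ dist f g := by
  by_cases hx : x ∈ Icc a b
  · have hab := hx.1.trans hx.2
    have hl := left_mem_Icc.2 hab
    have hr := right_mem_Icc.2 hab
    have h1 := f.integral_deriv_fn hl hx
    have h2 := g.integral_deriv_fn hl hx
    have hf := f.intervalIntegrable_deriv_fn hl hx
    have hg := g.intervalIntegrable_deriv_fn hl hx
    rw [fn_left] at h1 h2
    have h3 : f.fn x - g.fn x = ∫ t in a..x, (deriv f.fn t - deriv g.fn t) := by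
      rw [intervalIntegral.integral_sub hf hg]; linarith
    rw [h3]
    refine (intervalIntegral.abs_integral_le_integral_abs hx.1).trans ?_
    rw [intervalIntegral.integral_of_le hx.1, dist_def]
    refine setIntegral_mono_set ((integrableOn_deriv f).sub (integrableOn_deriv g)).abs
      (ae_of_all _ fun _ => abs_nonneg _) ?_
    exact (Ioc_subset_Icc_self.trans (Icc_subset_Icc_right hx.2)).eventuallyLE
  · rw [fn, fn, extendId_of_notMem _ hx, extendId_of_notMem _ hx, sub_self, abs_zero]
    exact dist_nonneg

/-- Elements that agree away from small neighbourhoods of the end points are close. -/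
lemma dist_le_of_eqOn {f g : HPlusAC a b} {c d : ℝ} (hac : a ≤ c) (hcd : c ≤ d) (hdb : d ≤ b)
    (h : EqOn f.fn g.fn (Icc c d)) : dist f g ≤ 2 * (f.fn c - a) + 2 * (b - f.fn d) := by
  have ha : a ∈ Icc a b := ⟨le_rfl, hac.trans (hcd.trans hdb)⟩
  have hb : b ∈ Icc a b := ⟨ha.2, le_rfl⟩
  have hc : c ∈ Icc a b := ⟨hac, hcd.trans hdb⟩
  have hd : d ∈ Icc a b := ⟨hac.trans hcd, hdb⟩
  have hint : ∀ x ∈ Icc a b, ∀ y ∈ Icc a b,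
      IntervalIntegrable (fun t => |deriv f.fn t - deriv g.fn t|) volume x y := fun x hx y hy =>
    ((f.intervalIntegrable_deriv_fn hx hy).sub (g.intervalIntegrable_deriv_fn hx hy)).abs
  -- As both derivatives are nonnegative, `|f' - g'| ≤ f' + g'`. The cost of any change on an
  -- interval is thus at most the sum of the lengths of its two images.
  have hle : ∀ x ∈ Icc a b, ∀ y ∈ Icc a b, x ≤ y →
      ∫ t in x..y, |deriv f.fn t - deriv g.fn t| ≤
        (f.fn y - f.fn x) + (g.fn y - g.fn x) := by
    intro x hx y hy hxy
    have hf := f.intervalIntegrable_deriv_fn hx hy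
    have hg := g.intervalIntegrable_deriv_fn hx hy
    rw [← f.integral_deriv_fn hx hy, ← g.integral_deriv_fn hx hy,
      ← intervalIntegral.integral_add hf hg]
    refine intervalIntegral.integral_mono_on hxy (hint x hx y hy) (hf.add hg) fun t _ => ?_
    have h1 := f.deriv_fn_nonneg t
    have h2 := g.deriv_fn_nonneg t
    rw [abs_le]
    constructor <;> linarith
  have h0 : ∫ t in c..d, |deriv f.fn t - deriv g.fn t| = 0 := by
    rw [intervalIntegral.integral_of_le hcd, integral_Ioc_eq_integral_Ioo]
    refine (setIntegral_congr_fun measurableSet_Ioo fun t ht => ?_).trans (integral_zero _ _)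
    have := (h.mono Ioo_subset_Icc_self).deriv isOpen_Ioo ht
    simp [this]
  have h1 := intervalIntegral.integral_add_adjacent_intervals (hint a ha c hc) (hint c hc d hd)
  have h2 := intervalIntegral.integral_add_adjacent_intervals (hint a ha d hd) (hint d hd b hb)
  have h3 := hle a ha c hc hac
  have h4 := hle d hd b hb hdb
  have h5 := h (left_mem_Icc.2 hcd)
  have h6 := h (right_mem_Icc.2 hcd)
  rw [fn_left, fn_left] at h3
  rw [fn_right, fn_right] at h4
  rw [dist_def, integral_Icc_eq_integral_Ioc, ← intervalIntegral.integral_of_le ha.2]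
  linarith

end HPlusAC

/-! ### The topological group structure -/

namespace HPlusAC

variable {a b : ℝ}

/-- Puts the metric in the form of a total variation, to which the reparametrization bound applies.
-/
lemma dist_eq_integral_abs_deriv_sub (f g : HPlusAC a b) :
    dist f g = ∫ x in Icc a b, |deriv (f.fn - g.fn) x| := by
  rw [dist_def]
  refine setIntegral_congr_ae measurableSet_Icc ?_
  filter_upwards [f.ae_differentiableAt_fn, g.ae_differentiableAt_fn] with x hf hg _
  rw [deriv_sub hf hg]

/-- The metric is right invariant. -/
lemma dist_mul_right_le (f h g : HPlusAC a b) : dist (f * g) (h * g) ≤ dist f h := by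
  rcases le_or_gt a b with hab | hab
  · rw [dist_eq_integral_abs_deriv_sub, dist_eq_integral_abs_deriv_sub]
    have : (f * g).fn - (h * g).fn = (f.fn - h.fn) ∘ g.fn := by
      funext x; simp only [Pi.sub_apply, fn_mul, Function.comp]
    rw [this]
    exact (f.fn_absolutelyContinuous.sub h.fn_absolutelyContinuous).integral_abs_deriv_comp_le hab
      (g.fn_strictMono.monotone.monotoneOn _) fun x hx => g.fn_mem_Icc hx
  · rw [dist_def, Icc_eq_empty hab.not_ge, setIntegral_empty]
    exact dist_nonneg

/-- Left multiplication by a fixed element is continuous. -/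
lemma continuous_mul_left' (f : HPlusAC a b) : Continuous fun g : HPlusAC a b => f * g := by
  rcases lt_or_ge b a with hab | hab
  · have : Subsingleton (HPlusAC a b) := ⟨fun f g => eq_of_fn_eqOn (by
      rw [Icc_eq_empty hab.not_ge]; exact eqOn_empty _ _)⟩
    exact continuous_of_const fun _ _ => Subsingleton.elim _ _
  rw [Metric.continuous_iff]
  intro g ε hε
  obtain ⟨φ, hφ, hsupp, hle⟩ := (integrableOn_deriv f).exists_continuous_approx
    (show 0 < ε / 5 by positivity)
  obtain ⟨M, hM⟩ := hsupp.exists_bound_of_continuous hφ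
  have hM0 : 0 ≤ M := (norm_nonneg _).trans (hM 0)
  obtain ⟨δ, hδ, hu⟩ := Metric.uniformContinuous_iff.1
    (hsupp.uniformContinuous_of_continuous hφ) (ε / 5 / (b - a + 1))
    (div_pos (by positivity) (by linarith))
  -- The first bound serves the uniform continuity of `φ`, the second the term `φ(g) (g₁' - g')`.
  -- The summands `1` in the denominators guard against `b = a` and `M = 0`.
  refine ⟨min δ (ε / 5 / (M + 1)), by positivity, fun g₁ hg₁ => ?_⟩
  set F : ℝ → ℝ := fun x => 0 + ∫ t in a..x, φ t with hF
  have hFd : ∀ x, HasDerivAt F (φ x) x := hφ.hasDerivAt_const_add_integral 0 a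
  have hFac : AbsolutelyContinuousOnInterval F a b :=
    (hφ.contDiff_const_add_integral 0 a).contDiffOn.absolutelyContinuousOnInterval
  set k := f.fn - F with hk
  have hkac : AbsolutelyContinuousOnInterval k a b := f.fn_absolutelyContinuous.sub hFac
  have hkint : ∫ x in Icc a b, |deriv k x| ≤ ε / 5 := by
    refine le_trans (le_of_eq ?_) hle
    refine setIntegral_congr_ae measurableSet_Icc ?_
    filter_upwards [f.ae_differentiableAt_fn] with x hf _
    rw [hk, deriv_sub hf (hFd x).differentiableAt, (hFd x).deriv]
  have hcomp : ∀ g' : HPlusAC a b, ∫ x in Icc a b, |deriv (k ∘ g'.fn) x| ≤ ε / 5 := fun g' =>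
    (hkac.integral_abs_deriv_comp_le hab (g'.fn_strictMono.monotone.monotoneOn _)
      fun x hx => g'.fn_mem_Icc hx).trans hkint
  have hcompint : ∀ g' : HPlusAC a b,
      IntegrableOn (fun x => |deriv (k ∘ g'.fn) x|) (Icc a b) := fun g' =>
    ((hkac.comp_monotone g'.fn_absolutelyContinuous g'.fn_strictMono.monotone
      (by rw [uIcc_of_le hab]; exact fun x hx => g'.fn_mem_Icc hx)).integrableOn_deriv hab).abs
  -- The chain rule is applied only to the smooth part `F`. The rough part `k` enters through the
  -- total variation of `k ∘ g'`, small uniformly in `g'`.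
  have hae : ∀ g' : HPlusAC a b, ∀ᵐ x, deriv (f * g').fn x =
      deriv (k ∘ g'.fn) x + φ (g'.fn x) * deriv g'.fn x := fun g' => by
    filter_upwards [(f * g').ae_differentiableAt_fn, g'.ae_differentiableAt_fn] with x h1 h2
    have h3 := (hFd (g'.fn x)).comp x h2.hasDerivAt
    have h4 : k ∘ g'.fn = (f * g').fn - F ∘ g'.fn := by
      funext y; simp only [hk, Pi.sub_apply, fn_mul, Function.comp]
    rw [h4, deriv_sub h1 h3.differentiableAt, h3.deriv]
    ring
  have hi0 : IntegrableOn (fun x => |deriv (k ∘ g₁.fn) x| + |deriv (k ∘ g.fn) x|) (Icc a b) :=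
    (hcompint g₁).add (hcompint g)
  have hi1 : IntegrableOn (fun x => ε / 5 / (b - a + 1) * deriv g₁.fn x) (Icc a b) :=
    (integrableOn_deriv g₁).const_mul (ε / 5 / (b - a + 1))
  have hi2 : IntegrableOn (fun x => M * |deriv g₁.fn x - deriv g.fn x|) (Icc a b) :=
    ((integrableOn_deriv g₁).sub (integrableOn_deriv g)).abs.const_mul M
  have hi3 : IntegrableOn (fun x => ε / 5 / (b - a + 1) * deriv g₁.fn x +
    M * |deriv g₁.fn x - deriv g.fn x|) (Icc a b) := hi1.add hi2
  have hbound : dist (f * g₁) (f * g) ≤ ∫ x in Icc a b,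
      ((|deriv (k ∘ g₁.fn) x| + |deriv (k ∘ g.fn) x|) +
        (ε / 5 / (b - a + 1) * deriv g₁.fn x + M * |deriv g₁.fn x - deriv g.fn x|)) := by
    rw [dist_def]
    refine integral_mono_ae ((integrableOn_deriv _).sub (integrableOn_deriv _)).abs
      (hi0.add hi3) (ae_restrict_of_ae ?_)
    filter_upwards [hae g₁, hae g] with x h1 h2
    have h3 : |φ (g₁.fn x) - φ (g.fn x)| ≤ ε / 5 / (b - a + 1) := by
      refine (hu ?_).le
      rw [Real.dist_eq]
      exact (abs_fn_sub_le_dist g₁ g x).trans_lt (hg₁.trans_le (min_le_left _ _))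
    have h4 : |φ (g.fn x)| ≤ M := hM _
    have h5 := g₁.deriv_fn_nonneg x
    have h6 : |(φ (g₁.fn x) - φ (g.fn x)) * deriv g₁.fn x| ≤
        ε / 5 / (b - a + 1) * deriv g₁.fn x := by
      rw [abs_mul, abs_of_nonneg h5]
      exact mul_le_mul_of_nonneg_right h3 h5
    have h7 : |φ (g.fn x) * (deriv g₁.fn x - deriv g.fn x)| ≤
        M * |deriv g₁.fn x - deriv g.fn x| := by
      rw [abs_mul]
      exact mul_le_mul_of_nonneg_right h4 (abs_nonneg _)
    -- Four error terms, each of integral at most `ε / 5`; the third uses that `g₁'` has total mass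
    -- `b - a`.
    have h8 : deriv (f * g₁).fn x - deriv (f * g).fn x =
        (deriv (k ∘ g₁.fn) x - deriv (k ∘ g.fn) x) +
          ((φ (g₁.fn x) - φ (g.fn x)) * deriv g₁.fn x +
            φ (g.fn x) * (deriv g₁.fn x - deriv g.fn x)) := by
      rw [h1, h2]; ring
    change |deriv (f * g₁).fn x - deriv (f * g).fn x| ≤ _
    rw [h8]
    exact (abs_add_le _ _).trans (add_le_add (abs_sub _ _)
      ((abs_add_le _ _).trans (add_le_add h6 h7)))
  rw [integral_add hi0 hi3,
    integral_add (hcompint g₁) (hcompint g), integral_add hi1 hi2, integral_const_mul,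
    integral_const_mul, integral_Icc_deriv_fn _ hab, ← dist_def] at hbound
  have h1 : ε / 5 / (b - a + 1) * (b - a) ≤ ε / 5 := by
    rw [div_mul_eq_mul_div, div_le_iff₀ (by linarith)]
    nlinarith
  have h2 : M * dist g₁ g ≤ ε / 5 := by
    have h3 := (hg₁.trans_le (min_le_right _ _)).le
    rw [le_div_iff₀ (by linarith)] at h3
    nlinarith [dist_nonneg (x := g₁) (y := g)]
  linarith [hcomp g₁, hcomp g]

/-- Right translation by `f⁻¹` takes `1` and `g⁻¹ f` to `f⁻¹` and `g⁻¹`. Writing `1` as `g⁻¹ g`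
reduces continuity of inversion to that of a left translation. -/
lemma dist_inv_le (f g : HPlusAC a b) : dist f⁻¹ g⁻¹ ≤ dist (g⁻¹ * g) (g⁻¹ * f) := by
  have := dist_mul_right_le (1 : HPlusAC a b) (g⁻¹ * f) f⁻¹
  rwa [one_mul, mul_assoc, mul_inv_cancel, mul_one, ← inv_mul_cancel g] at this

/-- Passing through the intermediate point `f * p.2`, one error is controlled by right invariance
and the other by continuity of left translation by the fixed `f`. -/
instance : IsTopologicalGroup (HPlusAC a b) where
  continuous_mul := by
    rw [continuous_iff_continuousAt]
    rintro ⟨f, g⟩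
    rw [ContinuousAt, tendsto_iff_dist_tendsto_zero]
    have h1 : Tendsto (fun p : HPlusAC a b × HPlusAC a b => dist p.1 f + dist (f * p.2) (f * g))
        (𝓝 (f, g)) (𝓝 (dist f f + dist (f * g) (f * g))) := by
      have := continuous_mul_left' f
      exact Continuous.tendsto (by fun_prop) (f, g)
    rw [dist_self, dist_self, add_zero] at h1
    refine squeeze_zero (fun _ => dist_nonneg) (fun p => ?_) h1
    exact (dist_triangle _ (f * p.2) _).trans (add_le_add_left (dist_mul_right_le _ _ _) _)
  continuous_inv := by
    rw [continuous_iff_continuousAt]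
    intro g
    rw [ContinuousAt, tendsto_iff_dist_tendsto_zero]
    have h1 : Tendsto (fun f : HPlusAC a b => dist (g⁻¹ * g) (g⁻¹ * f)) (𝓝 g)
        (𝓝 (dist (g⁻¹ * g) (g⁻¹ * g))) := by
      have := continuous_mul_left' g⁻¹
      exact Continuous.tendsto (by fun_prop) g
    rw [dist_self] at h1
    exact squeeze_zero (fun _ => dist_nonneg) (fun f => dist_inv_le f g) h1

/-! ### Complete metrizability and separability -/

lemma integrable_deriv_fn (f : HPlusAC a b) :
    Integrable (deriv f.fn) (volume.restrict (Icc a b)) := integrableOn_deriv f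

/-- The class of the derivative of `f` in `L¹([a, b])`. -/
noncomputable def derivL1 (f : HPlusAC a b) : Lp ℝ 1 (volume.restrict (Icc a b)) :=
  f.integrable_deriv_fn.toL1 (deriv f.fn)

lemma isometry_derivL1 : Isometry (derivL1 : HPlusAC a b → _) := by
  refine Isometry.of_dist_eq fun f g => ?_
  rw [derivL1, derivL1, dist_eq_norm, ← Integrable.toL1_sub, L1.norm_of_fun_eq_integral_norm,
    dist_def]
  rfl

/-- The uniform distance of `f` to a primitive of `φ` is bounded by the `L¹` distance of `f'` to `φ`. -/
lemma abs_fn_sub_integral_le (f : HPlusAC a b) (φ : Lp ℝ 1 (volume.restrict (Icc a b))) {x : ℝ}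
    (hx : x ∈ Icc a b) : |f.fn x - (a + ∫ t in a..x, φ t)| ≤ dist (derivL1 f) φ := by
  have hφ : IntegrableOn φ (Icc a b) := L1.integrable_coeFn φ
  have hab := hx.1.trans hx.2
  have hl := left_mem_Icc.2 hab
  have hsub : Ioc a x ⊆ Icc a b := Ioc_subset_Icc_self.trans (Icc_subset_Icc_right hx.2)
  have h1 := f.integral_deriv_fn hl hx
  rw [fn_left] at h1
  have h3 : f.fn x - (a + ∫ t in a..x, φ t) = ∫ t in a..x, (deriv f.fn t - φ t) := by
    rw [intervalIntegral.integral_sub (f.intervalIntegrable_deriv_fn hl hx)]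
    · linarith
    · rw [intervalIntegrable_iff_integrableOn_Ioc_of_le hx.1]
      exact hφ.mono_set hsub
  rw [h3]
  refine (intervalIntegral.abs_integral_le_integral_abs hx.1).trans ?_
  rw [intervalIntegral.integral_of_le hx.1, L1.dist_eq_integral_dist]
  have h4 : ∫ t in Icc a b, dist (derivL1 f t) (φ t) = ∫ t in Icc a b, |deriv f.fn t - φ t| := by
    refine integral_congr_ae ?_
    filter_upwards [f.integrable_deriv_fn.coeFn_toL1] with t ht
    rw [derivL1, ht, Real.dist_eq]
  rw [h4]
  exact setIntegral_mono_set ((integrableOn_deriv f).sub hφ).abs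
    (ae_of_all _ fun _ => abs_nonneg _) hsub.eventuallyLE

/-- If `f` is a primitive of `φ`, then `φ` is the derivative of `f`. -/
lemma derivL1_eq {f : HPlusAC a b} {φ : Lp ℝ 1 (volume.restrict (Icc a b))}
    (h : EqOn f.fn (fun x => a + ∫ t in a..x, φ t) (Icc a b)) : derivL1 f = φ := by
  refine Lp.ext ?_
  have hφ : IntegrableOn φ (Icc a b) := L1.integrable_coeFn φ
  refine f.integrable_deriv_fn.coeFn_toL1.trans ?_
  rcases lt_or_ge b a with hab | hab
  · rw [EventuallyEq, ae_restrict_iff' measurableSet_Icc]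
    exact ae_of_all _ fun x hx => absurd (hx.1.trans hx.2) hab.not_ge
  have h1 := ((intervalIntegrable_iff_integrableOn_Icc_of_le hab).2 hφ).ae_hasDerivAt_integral
  have ha : ∀ᵐ x : ℝ, x ≠ a := by simp [ae_iff, measure_singleton]
  have hb : ∀ᵐ x : ℝ, x ≠ b := by simp [ae_iff, measure_singleton]
  rw [EventuallyEq, ae_restrict_iff' measurableSet_Icc]
  filter_upwards [h1, ha, hb] with x hx hxa hxb hmem
  have hs : Icc a b ∈ 𝓝 x := Icc_mem_nhds (lt_of_le_of_ne hmem.1 hxa.symm)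
    (lt_of_le_of_ne hmem.2 hxb)
  rw [uIcc_of_le hab] at hx
  have h2 := (hx hmem a (left_mem_Icc.2 hab)).const_add a
  exact (h2.congr_of_eventuallyEq (h.eventuallyEq_of_mem hs)).deriv

/-- The derivative alone is an isometric embedding, but an `L¹` limit of derivatives may vanish on
an interval. Recording `(f⁻¹)'` as well closes the range: the primitives of the two limits remain
mutually inverse. -/
instance : PolishSpace (HPlusAC a b) := by
  have : Fact ((1 : ENNReal) ≠ ⊤) := ⟨ENNReal.one_ne_top⟩
  let Φ : HPlusAC a b → Lp ℝ 1 (volume.restrict (Icc a b)) × Lp ℝ 1 (volume.restrict (Icc a b)) :=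
    fun f => (derivL1 f, derivL1 f⁻¹)
  have hcont : Continuous Φ := isometry_derivL1.continuous.prodMk
    (isometry_derivL1.continuous.comp continuous_inv)
  have hemb : IsEmbedding Φ := IsEmbedding.of_comp hcont continuous_fst
    isometry_derivL1.isEmbedding
  refine IsClosedEmbedding.polishSpace (f := Φ) ⟨hemb, IsSeqClosed.isClosed ?_⟩
  rcases lt_or_ge b a with hab | hab
  · intro x p _ _
    have hs : ∀ u v : Lp ℝ 1 (volume.restrict (Icc a b)), u = v := fun u v => Lp.ext (by
      rw [EventuallyEq, ae_restrict_iff' measurableSet_Icc]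
      exact ae_of_all _ fun x hx => absurd (hx.1.trans hx.2) hab.not_ge)
    exact ⟨1, Prod.ext (hs _ _) (hs _ _)⟩
  rintro x ⟨φ, ψ⟩ hx hlim
  choose f hf using hx
  obtain rfl : (fun n => Φ (f n)) = x := funext hf
  have hφ : Tendsto (fun n => dist (derivL1 (f n)) φ) atTop (𝓝 0) :=
    tendsto_iff_dist_tendsto_zero.1 ((continuous_fst.tendsto _).comp hlim)
  have hψ : Tendsto (fun n => dist (derivL1 (f n)⁻¹) ψ) atTop (𝓝 0) :=
    tendsto_iff_dist_tendsto_zero.1 ((continuous_snd.tendsto _).comp hlim)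
  have hpt : ∀ (g : ℕ → HPlusAC a b) (χ : Lp ℝ 1 (volume.restrict (Icc a b))),
      Tendsto (fun n => dist (derivL1 (g n)) χ) atTop (𝓝 0) → ∀ y ∈ Icc a b,
      Tendsto (fun n => (g n).fn y) atTop (𝓝 (a + ∫ t in a..y, χ t)) := fun g χ h y hy =>
    tendsto_iff_dist_tendsto_zero.2
      (squeeze_zero (fun _ => dist_nonneg) (fun n => abs_fn_sub_integral_le (g n) χ hy) h)
  have hac : ∀ χ : Lp ℝ 1 (volume.restrict (Icc a b)),
      AbsolutelyContinuousOnInterval (fun y => a + ∫ t in a..y, χ t) a b := fun χ =>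
    (LipschitzWith.const a).lipschitzOnWith.absolutelyContinuousOnInterval.fun_add
      (((intervalIntegrable_iff_integrableOn_Icc_of_le hab).2
        (L1.integrable_coeFn χ)).absolutelyContinuousOnInterval_intervalIntegral left_mem_uIcc)
  have hmaps : ∀ (g : ℕ → HPlusAC a b) (χ : Lp ℝ 1 (volume.restrict (Icc a b))),
      Tendsto (fun n => dist (derivL1 (g n)) χ) atTop (𝓝 0) →
      MapsTo (fun y => a + ∫ t in a..y, χ t) (Icc a b) (Icc a b) := fun g χ h y hy =>
    isClosed_Icc.mem_of_tendsto (hpt g χ h y hy)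
      (Eventually.of_forall fun n => (g n).fn_mem_Icc hy)
  have hinv : ∀ (g : ℕ → HPlusAC a b) (χ ω : Lp ℝ 1 (volume.restrict (Icc a b))),
      Tendsto (fun n => dist (derivL1 (g n)) χ) atTop (𝓝 0) →
      Tendsto (fun n => dist (derivL1 (g n)⁻¹) ω) atTop (𝓝 0) →
      LeftInvOn (fun y => a + ∫ t in a..y, χ t) (fun y => a + ∫ t in a..y, ω t) (Icc a b) := by
    intro g χ ω h1 h2 y hy
    have h3 := hpt (fun n => (g n)⁻¹) ω h2 y hy
    have h4 := (hac χ).continuousOn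
    rw [uIcc_of_le hab] at h4
    have h5 := (h4 _ (hmaps _ ω h2 hy)).tendsto.comp (tendsto_nhdsWithin_iff.2
      ⟨h3, Eventually.of_forall fun n => (g n)⁻¹.fn_mem_Icc hy⟩)
    -- The bound of `abs_fn_sub_integral_le` does not depend on the point, so it may be used at the
    -- moving point `(g n)⁻¹ y`.
    have h6 : Tendsto (fun n => a + ∫ t in a..((g n)⁻¹.fn y), χ t) atTop (𝓝 y) := by
      rw [tendsto_iff_dist_tendsto_zero]
      refine squeeze_zero (fun _ => dist_nonneg) (fun n => ?_) h1
      have := abs_fn_sub_integral_le (g n) χ ((g n)⁻¹.fn_mem_Icc hy)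
      rwa [fn_fn_inv, ← Real.dist_eq, dist_comm] at this
    exact tendsto_nhds_unique h5 h6
  obtain ⟨k, hk, hk'⟩ := exists_of_inverse (hac φ) (hac ψ) (hmaps f φ hφ)
    (hmaps (fun n => (f n)⁻¹) ψ hψ)
    (fun x hx y hy hxy => le_of_tendsto_of_tendsto' (hpt f φ hφ x hx) (hpt f φ hφ y hy)
      fun n => (f n).fn_strictMono.monotone hxy)
    (hinv (fun n => (f n)⁻¹) ψ φ hψ (by simpa only [inv_inv] using hφ)) (hinv f φ ψ hφ hψ)
  exact ⟨k, Prod.ext (derivL1_eq hk) (derivL1_eq hk')⟩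

end HPlusAC

/-! ### Removing common fixed points -/

namespace HPlusAC

variable {a b : ℝ}

/-- Every element is approximated by elements of the form `x ↦ F x + s (x - a) (b - x)` where `F` is
`C¹` and `s` is an arbitrary small parameter. -/
lemma exists_contDiff_perturbation (hab : a < b) (f : HPlusAC a b) {ε : ℝ} (hε : 0 < ε) :
    ∃ F : ℝ → ℝ, ContDiff ℝ 1 F ∧ ∃ η > 0, ∀ s : ℝ, |s| < η →
      ∃ k : HPlusAC a b, dist f k < ε ∧ ∀ x ∈ Icc a b, k.fn x = F x + s * ((x - a) * (b - x)) := by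
  have hL : 0 < b - a := sub_pos.2 hab
  -- Covers the approximation error `τ` plus the cost `τ (b - a)` of lifting `|φ₀|` to a positive
  -- function.
  set τ := ε / 4 / (1 + (b - a)) with hτ
  have hτ0 : 0 < τ := by positivity
  have hτε : τ * (1 + (b - a)) = ε / 4 := by rw [hτ]; field_simp
  obtain ⟨φ₀, hφ₀, -, hle⟩ := (integrableOn_deriv f).exists_continuous_approx hτ0
  set φ₁ : ℝ → ℝ := fun x => |φ₀ x| + τ with hφ₁
  have hφ₁c : Continuous φ₁ := hφ₀.abs.add continuous_const
  have hφ₁i : IntegrableOn φ₁ (Icc a b) := hφ₁c.integrableOn_Icc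
  have hi1 : IntegrableOn (fun x => |deriv f.fn x - φ₀ x|) (Icc a b) :=
    ((integrableOn_deriv f).sub hφ₀.integrableOn_Icc).abs
  have hi2 : IntegrableOn (fun x => |deriv f.fn x - φ₁ x|) (Icc a b) :=
    ((integrableOn_deriv f).sub hφ₁i).abs
  have hle₁ : ∫ x in Icc a b, |deriv f.fn x - φ₁ x| ≤ ε / 4 := by
    have h1 : ∫ x in Icc a b, |deriv f.fn x - φ₁ x| ≤
        ∫ x in Icc a b, (|deriv f.fn x - φ₀ x| + τ) := by
      refine integral_mono hi2 (hi1.add (integrable_const τ)) fun x => ?_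
      have h2 : |deriv f.fn x| = deriv f.fn x := abs_of_nonneg (f.deriv_fn_nonneg x)
      have h3 := abs_abs_sub_abs_le_abs_sub (deriv f.fn x) (φ₀ x)
      rw [h2] at h3
      have h4 : deriv f.fn x - φ₁ x = (deriv f.fn x - |φ₀ x|) + (-τ) := by rw [hφ₁]; ring
      change |deriv f.fn x - φ₁ x| ≤ |deriv f.fn x - φ₀ x| + τ
      rw [h4]
      refine (abs_add_le _ _).trans (add_le_add h3 ?_)
      rw [abs_neg, abs_of_pos hτ0]
    rw [integral_add hi1 (integrable_const τ), setIntegral_const, smul_eq_mul,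
      Real.volume_real_Icc_of_le hab.le] at h1
    linarith
  set I := ∫ x in Icc a b, φ₁ x with hI
  have hI0 : 0 < I := by
    have h1 : ∫ x in Icc a b, τ ≤ I :=
      integral_mono (integrable_const τ) hφ₁i fun x => le_add_of_nonneg_left (abs_nonneg _)
    rw [setIntegral_const, smul_eq_mul, Real.volume_real_Icc_of_le hab.le] at h1
    exact lt_of_lt_of_le (by positivity) h1
  -- Normalizes the total mass so that the primitive fixes `b`.
  set c := (b - a) / I with hc
  have hc0 : 0 < c := by positivity
  have hcI : c * I = b - a := by rw [hc]; field_simp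
  set φ : ℝ → ℝ := fun x => c * φ₁ x with hφ
  have hφc : Continuous φ := continuous_const.mul hφ₁c
  have hφi : IntegrableOn φ (Icc a b) := hφc.integrableOn_Icc
  have hi3 : IntegrableOn (fun x => |deriv f.fn x - φ x|) (Icc a b) :=
    ((integrableOn_deriv f).sub hφi).abs
  have hIle : |I - (b - a)| ≤ ε / 4 := by
    rw [hI, ← f.integral_Icc_deriv_fn hab.le, ← integral_sub hφ₁i (integrableOn_deriv f)]
    refine (abs_integral_le_integral_abs).trans (le_trans (le_of_eq ?_) hle₁)
    exact integral_congr_ae (ae_of_all _ fun x => abs_sub_comm _ _)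
  have hleφ : ∫ x in Icc a b, |deriv f.fn x - φ x| ≤ ε / 2 := by
    have h1 : ∫ x in Icc a b, |deriv f.fn x - φ x| ≤
        ∫ x in Icc a b, (|deriv f.fn x - φ₁ x| + |1 - c| * φ₁ x) := by
      refine integral_mono hi3 (hi2.add (hφ₁i.const_mul _)) fun x => ?_
      have h2 : deriv f.fn x - φ x = (deriv f.fn x - φ₁ x) + (1 - c) * φ₁ x := by
        rw [hφ]; ring
      have h3 : 0 ≤ φ₁ x := by positivity
      change |deriv f.fn x - φ x| ≤ |deriv f.fn x - φ₁ x| + |1 - c| * φ₁ x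
      rw [h2]
      refine (abs_add_le _ _).trans (add_le_add le_rfl ?_)
      rw [abs_mul, abs_of_nonneg h3]
    rw [integral_add hi2 (hφ₁i.const_mul _), integral_const_mul, ← hI] at h1
    have h2 : |1 - c| * I = |I - (b - a)| := by
      rw [← hcI, ← abs_of_pos hI0, ← abs_mul, abs_of_pos hI0]; congr 1; ring
    linarith
  set F : ℝ → ℝ := fun x => a + ∫ t in a..x, φ t with hF
  have hFC : ContDiff ℝ 1 F := hφc.contDiff_const_add_integral a a
  have hFd : ∀ x, HasDerivAt F (φ x) x := hφc.hasDerivAt_const_add_integral a a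
  have hFa : F a = a := by simp [hF]
  have hFb : F b = b := by
    simp only [hF, hφ]
    rw [intervalIntegral.integral_const_mul, intervalIntegral.integral_of_le hab.le,
      ← integral_Icc_eq_integral_Ioc, ← hI, hcI]
    ring
  have hβ : ∀ s x : ℝ, HasDerivAt (fun x => F x + s * ((x - a) * (b - x)))
      (φ x + s * (a + b - 2 * x)) x := fun s x => by
    have h1 := (((hasDerivAt_id x).sub_const a).mul ((hasDerivAt_id x).const_sub b)).const_mul s
    refine ((hFd x).add h1).congr_deriv ?_
    simp only [id]
    ring
  have hβle : ∀ s, ∀ x ∈ Icc a b, |s * (a + b - 2 * x)| ≤ |s| * (b - a) := fun s x hx => by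
    rw [abs_mul]
    refine mul_le_mul_of_nonneg_left (abs_le.2 ⟨?_, ?_⟩) (abs_nonneg _) <;>
      linarith [hx.1, hx.2]
  -- The first bound keeps the derivative above `c τ / 2`; the second keeps the `L¹` size of the
  -- perturbation below `ε / 4`.
  refine ⟨F, hFC, min (c * τ / 2 / (b - a)) (ε / 4 / (b - a) / (b - a)), by positivity,
    fun s hs => ?_⟩
  have hs1 : |s| * (b - a) < c * τ / 2 := by
    have := hs.trans_le (min_le_left _ _)
    rwa [lt_div_iff₀ hL] at this
  have hs2 : |s| * (b - a) * (b - a) < ε / 4 := by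
    have := hs.trans_le (min_le_right _ _)
    rwa [lt_div_iff₀ hL, lt_div_iff₀ hL] at this
  obtain ⟨k, hk⟩ := exists_of_contDiff (F := fun x => F x + s * ((x - a) * (b - x)))
    (m := c * τ / 2) hab.le (by positivity) (by fun_prop) (by simp [hFa]) (by simp [hFb])
    (fun x hx => by
      rw [(hβ s x).deriv]
      have h1 := neg_abs_le (s * (a + b - 2 * x))
      have h2 := hβle s x hx
      have h3 : c * τ ≤ φ x :=
        mul_le_mul_of_nonneg_left (le_add_of_nonneg_left (abs_nonneg _)) hc0.le
      linarith)
  refine ⟨k, ?_, fun x hx => hk hx⟩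
  have hi4 : IntegrableOn (fun x => |deriv f.fn x - deriv k.fn x|) (Icc a b) :=
    ((integrableOn_deriv f).sub (integrableOn_deriv k)).abs
  have hdist : dist f k ≤ ∫ x in Icc a b, (|deriv f.fn x - φ x| + |s| * (b - a)) := by
    rw [dist_def, integral_Icc_eq_integral_Ioo, integral_Icc_eq_integral_Ioo]
    have hsub : Ioo a b ⊆ Icc a b := Ioo_subset_Icc_self
    refine setIntegral_mono_on
      (hi4.mono_set hsub) ((hi3.mono_set hsub).add (integrable_const _)) measurableSet_Ioo fun x hx => ?_
    have h1 : deriv k.fn x = φ x + s * (a + b - 2 * x) :=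
      ((hk.mono hsub).deriv isOpen_Ioo hx).trans (hβ s x).deriv
    have h2 := hβle s x (hsub hx)
    change |deriv f.fn x - deriv k.fn x| ≤ _
    rw [h1, show deriv f.fn x - (φ x + s * (a + b - 2 * x)) =
      (deriv f.fn x - φ x) + -(s * (a + b - 2 * x)) by ring]
    refine (abs_add_le _ _).trans (add_le_add le_rfl ?_)
    rwa [abs_neg]
  rw [integral_add hi3 (integrable_const _), setIntegral_const, smul_eq_mul,
    Real.volume_real_Icc_of_le hab.le] at hdist
  linarith

/-- The members of two `C¹` families have no common fixed points for some small parameters. -/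
lemma exists_no_common_fixed_parameters {F G : ℝ → ℝ} (hF : ContDiff ℝ 1 F)
    (hG : ContDiff ℝ 1 G) {η : ℝ} (hη : 0 < η) :
    ∃ s t : ℝ, |s| < η ∧ |t| < η ∧ ∀ x ∈ Ioo a b,
      ¬ (F x + s * ((x - a) * (b - x)) = x ∧ G x + t * ((x - a) * (b - x)) = x) := by
  have hβ : ∀ x ∈ Ioo a b, (x - a) * (b - x) ≠ 0 := fun x hx =>
    (mul_pos (sub_pos.2 hx.1) (sub_pos.2 hx.2)).ne'
  -- At each `x` exactly one parameter pair makes `x` a common fixed point. These pairs trace a `C¹`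
  -- curve, whose complement in the plane is dense.
  have hcurve : ContDiffOn ℝ 1 (fun x => ((x - F x) / ((x - a) * (b - x)),
      (x - G x) / ((x - a) * (b - x)))) (Ioo a b) :=
    ((contDiff_id.sub hF).contDiffOn.div (by fun_prop) hβ).prodMk
      ((contDiff_id.sub hG).contDiffOn.div (by fun_prop) hβ)
  have hdense := hcurve.dense_compl_image_of_dimH_lt_finrank (convex_Ioo a b) subset_rfl
    ((dimH_mono (subset_univ _)).trans_lt (by rw [Real.dimH_univ]; norm_num))
  obtain ⟨⟨s, t⟩, hst, hmem⟩ := hdense.exists_mem_open (Metric.isOpen_ball (x := (0, 0)) (ε := η))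
    (Metric.nonempty_ball.2 hη)
  rw [Metric.mem_ball, Prod.dist_eq, max_lt_iff, Real.dist_eq, Real.dist_eq, sub_zero,
    sub_zero] at hmem
  refine ⟨s, t, hmem.1, hmem.2, fun x hx hfix => hst ⟨x, hx, ?_⟩⟩
  refine Prod.ext ?_ ?_
  · rw [div_eq_iff (hβ x hx)]; linarith [hfix.1]
  · rw [div_eq_iff (hβ x hx)]; linarith [hfix.2]

/-- The pairs without common fixed points in `(a, b)` are dense. -/
lemma exists_no_common_fixed_near (hab : a < b) (f g : HPlusAC a b) {ε : ℝ} (hε : 0 < ε) :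
    ∃ f' g' : HPlusAC a b, dist f f' < ε ∧ dist g g' < ε ∧
      ∀ x ∈ Ioo a b, ¬ (f'.fn x = x ∧ g'.fn x = x) := by
  obtain ⟨F, hF, η, hη, hFk⟩ := exists_contDiff_perturbation hab f hε
  obtain ⟨G, hG, θ, hθ, hGk⟩ := exists_contDiff_perturbation hab g hε
  obtain ⟨s, t, hs, ht, hst⟩ := exists_no_common_fixed_parameters (a := a) (b := b) hF hG
    (lt_min hη hθ)
  obtain ⟨f', hf', hfe⟩ := hFk s (hs.trans_le (min_le_left _ _))
  obtain ⟨g', hg', hge⟩ := hGk t (ht.trans_le (min_le_right _ _))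
  refine ⟨f', g', hf', hg', fun x hx => ?_⟩
  rw [hfe x (Ioo_subset_Icc_self hx), hge x (Ioo_subset_Icc_self hx)]
  exact hst x hx

/-! ### Dynamics near the end points -/

/-- Orbits of a group without global fixed points accumulate at `b`. -/
lemma exists_mem_lt_fn {Γ : Subgroup (HPlusAC a b)}
    (hΓ : ∀ x ∈ Ioo a b, ∃ k ∈ Γ, k.fn x ≠ x) {r D : ℝ} (hr : r ∈ Ioo a b) (hD : D < b) :
    ∃ k ∈ Γ, D < k.fn r := by
  set S : Set ℝ := {y | ∃ k ∈ Γ, k.fn r = y} with hS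
  have hSr : r ∈ S := ⟨1, one_mem _, fn_one r⟩
  have hSb : ∀ y ∈ S, y ≤ b := by
    rintro y ⟨k, -, rfl⟩
    exact (k.fn_mem_Ioo hr).2.le
  have hlub : IsLUB S (sSup S) := isLUB_csSup ⟨r, hSr⟩ ⟨b, hSb⟩
  have hle : ∀ k ∈ Γ, k.fn (sSup S) ≤ sSup S := by
    intro k hk
    by_contra! hlt
    obtain ⟨_, ⟨k', hk', rfl⟩, hlt', -⟩ := hlub.exists_between (fn_inv_lt_iff.2 hlt)
    have h1 := hlub.1 ⟨k * k', mul_mem hk hk', rfl⟩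
    rw [fn_mul] at h1
    exact absurd (fn_inv_lt_iff.1 hlt') h1.not_gt
  -- The supremum of an orbit is fixed by the whole group, so it cannot lie in `(a, b)`.
  have hfix : ∀ k ∈ Γ, k.fn (sSup S) = sSup S := fun k hk =>
    le_antisymm (hle k hk) (by
      have := k.fn_strictMono.monotone (hle _ (inv_mem hk))
      rwa [fn_fn_inv] at this)
  have hb : sSup S = b := by
    by_contra hne
    obtain ⟨k, hk, hk'⟩ := hΓ (sSup S)
      ⟨hr.1.trans_le (hlub.1 hSr), lt_of_le_of_ne (hlub.2 hSb) hne⟩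
    exact hk' (hfix k hk)
  obtain ⟨_, ⟨k, hk, rfl⟩, hlt, -⟩ := hlub.exists_between (hb.symm ▸ hD)
  exact ⟨k, hk, hlt⟩

/-- The negative iterates of an element that moves `(a, r]` up converge to `a`. -/
lemma exists_inv_pow_lt {e : HPlusAC a b} {r p : ℝ}
    (he : ∀ x ∈ Ioc a r, x < e.fn x) (hp : a < p) : ∃ N : ℕ, (e ^ N)⁻¹.fn r < p := by
  by_contra! hcon
  set S : Set ℝ := range fun N : ℕ => (e ^ N)⁻¹.fn r with hS
  have hSr : r ∈ S := ⟨0, by simp only [pow_zero, inv_one]; exact fn_one r⟩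
  have hSp : ∀ y ∈ S, p ≤ y := by
    rintro _ ⟨N, rfl⟩
    exact hcon N
  have hglb : IsGLB S (sInf S) := isGLB_csInf ⟨r, hSr⟩ ⟨p, hSp⟩
  -- The infimum is moved up, so some iterate lies below its image, and the next iterate falls below
  -- the infimum.
  have hlt := he _ ⟨hp.trans_le (hglb.2 hSp), hglb.1 hSr⟩
  obtain ⟨_, ⟨N, rfl⟩, -, hN⟩ := hglb.exists_between hlt
  have h1 := hglb.1 ⟨N + 1, rfl⟩
  dsimp only at h1 hN
  rw [pow_succ, mul_inv_rev, fn_mul] at h1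
  exact absurd (fn_inv_lt_iff.2 hN) h1.not_gt

/-- An element of `⟨f, g⟩` acts on `[y, b]` in the same way as an element of `⟨f, g'⟩` if `g'` agrees
with `g` outside a small neighbourhood of `a`. -/
lemma exists_eqOn_of_mem_closure {f g k : HPlusAC a b} (hk : k ∈ Subgroup.closure {f, g}) :
    ∀ y ∈ Ioo a b, ∃ p ∈ Ioo a b, ∀ g' : HPlusAC a b, EqOn g'.fn g.fn (Icc p b) →
      ∃ k' ∈ Subgroup.closure {f, g'}, EqOn k'.fn k.fn (Icc y b) := by
  induction hk using Subgroup.closure_induction with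
  | mem x hx =>
    intro y hy
    refine ⟨y, hy, fun g' hg' => ?_⟩
    rcases hx with rfl | rfl
    · exact ⟨x, Subgroup.subset_closure (by simp), eqOn_refl _ _⟩
    · exact ⟨g', Subgroup.subset_closure (by simp), hg'⟩
  | one => exact fun y hy => ⟨y, hy, fun g' _ => ⟨1, one_mem _, eqOn_refl _ _⟩⟩
  | mul k₁ k₂ _ _ ih₁ ih₂ =>
    intro y hy
    obtain ⟨p₂, hp₂, h₂⟩ := ih₂ y hy
    obtain ⟨p₁, hp₁, h₁⟩ := ih₁ (k₂.fn y) (k₂.fn_mem_Ioo hy)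
    refine ⟨min p₁ p₂, ⟨lt_min hp₁.1 hp₂.1, (min_le_left _ _).trans_lt hp₁.2⟩, fun g' hg' => ?_⟩
    obtain ⟨k₁', hk₁', he₁⟩ := h₁ g' (hg'.mono (Icc_subset_Icc_left (min_le_left _ _)))
    obtain ⟨k₂', hk₂', he₂⟩ := h₂ g' (hg'.mono (Icc_subset_Icc_left (min_le_right _ _)))
    refine ⟨k₁' * k₂', mul_mem hk₁' hk₂', fun z hz => ?_⟩
    rw [fn_mul, fn_mul, he₂ hz]
    exact he₁ ⟨k₂.fn_strictMono.monotone hz.1, (k₂.fn_mem_Icc ⟨hy.1.le.trans hz.1, hz.2⟩).2⟩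
  | inv k _ ih =>
    intro y hy
    obtain ⟨p, hp, h⟩ := ih (k⁻¹.fn y) (k⁻¹.fn_mem_Ioo hy)
    refine ⟨p, hp, fun g' hg' => ?_⟩
    obtain ⟨k', hk', he⟩ := h g' hg'
    refine ⟨k'⁻¹, inv_mem hk', fun z hz => fn_inv_eq ?_⟩
    rw [he ⟨k⁻¹.fn_strictMono.monotone hz.1, (k⁻¹.fn_mem_Icc ⟨hy.1.le.trans hz.1, hz.2⟩).2⟩,
      fn_fn_inv]

/-! ### Approximating a given element by conjugation -/

/-- If `f` and `g` have no common fixed points in `(a, b)` and `f^{±1}` moves the points near `a` up,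
then `g` can be changed slightly near `a` so that `⟨f, g⟩` comes close to a given element. -/
lemma exists_near_of_no_common_fixed (hab : a < b) {f g e : HPlusAC a b}
    (hfg : ∀ x ∈ Ioo a b, ¬ (f.fn x = x ∧ g.fn x = x)) (he : e = f ∨ e = f⁻¹) {r : ℝ}
    (hr : r ∈ Ioo a b) (her : ∀ x ∈ Ioc a r, x < e.fn x) (h : HPlusAC a b) {ε : ℝ} (hε : 0 < ε) :
    ∃ g' : HPlusAC a b, dist g g' < ε ∧ ∃ w ∈ Subgroup.closure {f, g'}, dist h w < ε := by
  -- With `τ ≤ ε / 8`, agreement with `h` on `[c, d]` costs at most `4 τ`. The bound `(b - a) / 4`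
  -- ensures `a + τ < b - τ`.
  obtain ⟨τ, hτ0, hτε, hτL⟩ : ∃ τ > 0, τ ≤ ε / 8 ∧ τ ≤ (b - a) / 4 :=
    ⟨min (ε / 8) ((b - a) / 4), lt_min (by positivity) (by linarith), min_le_left _ _,
      min_le_right _ _⟩
  have hl : a + τ ∈ Ioo a b := ⟨by linarith, by linarith⟩
  have hu : b - τ ∈ Ioo a b := ⟨by linarith, by linarith⟩
  obtain ⟨c, hc, hhc⟩ : ∃ c ∈ Ioo a b, h.fn c = a + τ :=
    ⟨_, h⁻¹.fn_mem_Ioo hl, h.fn_fn_inv _⟩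
  obtain ⟨d, hd, hhd⟩ : ∃ d ∈ Ioo a b, h.fn d = b - τ :=
    ⟨_, h⁻¹.fn_mem_Ioo hu, h.fn_fn_inv _⟩
  obtain ⟨p₀, hp₀, hgp₀⟩ : ∃ p ∈ Ioo a b, g.fn p = a + τ :=
    ⟨_, g⁻¹.fn_mem_Ioo hl, g.fn_fn_inv _⟩
  have hcd : c < d := by rw [← h.fn_strictMono.lt_iff_lt, hhc, hhd]; linarith
  set C := min c (h.fn c) with hC
  set D := max d (h.fn d) with hD
  have hCmem : C ∈ Ioo a b :=
    ⟨lt_min hc.1 (h.fn_mem_Ioo hc).1, (min_le_left _ _).trans_lt hc.2⟩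
  have hDb : D < b := max_lt hd.2 (h.fn_mem_Ioo hd).2
  obtain ⟨k, hk, hDk⟩ := exists_mem_lt_fn (Γ := Subgroup.closure {f, g}) (fun x hx => by
    by_contra! hcon
    exact hfg x hx ⟨hcon f (Subgroup.subset_closure (by simp)),
      hcon g (Subgroup.subset_closure (by simp))⟩) hr hDb
  obtain ⟨p, hp, hword⟩ := exists_eqOn_of_mem_closure hk _ (k⁻¹.fn_mem_Ioo hCmem)
  obtain ⟨p₂, hp₂, hp₂p, hp₂p₀⟩ : ∃ p₂ ∈ Ioo a b, p₂ ≤ p ∧ p₂ ≤ p₀ :=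
    ⟨min p p₀, ⟨lt_min hp.1 hp₀.1, (min_le_left _ _).trans_lt hp.2⟩, min_le_left _ _,
      min_le_right _ _⟩
  obtain ⟨N, hN⟩ := exists_inv_pow_lt her (lt_min hp₂.1 (g.fn_mem_Ioo hp₂).1)
  -- `k⁻¹` takes `[a, D]` below `r`, and `e ^ N` is large enough for its inverse to push this below
  -- both `p₂` and `g p₂`.
  set x := k * e ^ N with hx
  have hxlt : ∀ y, y ≤ D → x⁻¹.fn y < min p₂ (g.fn p₂) := fun y hy => by
    refine lt_trans ?_ hN
    rw [hx, mul_inv_rev, fn_mul]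
    exact (e ^ N)⁻¹.fn_strictMono (fn_inv_lt_iff.2 (hy.trans_lt hDk))
  have hd' : x⁻¹.fn d ∈ Ioo a b := x⁻¹.fn_mem_Ioo hd
  have hu_eq : (x⁻¹ * h * x).fn (x⁻¹.fn d) = x⁻¹.fn (h.fn d) := by
    rw [fn_mul, fn_mul, fn_fn_inv]
  have hd'p₂ : x⁻¹.fn d < p₂ := (hxlt d (le_max_left _ _)).trans_le (min_le_left _ _)
  have hv' : x⁻¹.fn (h.fn d) < g.fn p₂ :=
    (hxlt _ (le_max_right _ _)).trans_le (min_le_right _ _)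
  -- `v` bridges the gap between the conjugate of `h` on `[a, x⁻¹ d]` and `g` on `[p₂, b]`.
  obtain ⟨v, hv₁, hv₂⟩ := exists_interpolate hd'.1 hd'p₂ hp₂.2
    (x⁻¹.fn_mem_Ioo (h.fn_mem_Ioo hd)).1 hv' (g.fn_mem_Ioo hp₂).2
  obtain ⟨g₁, hg₁l, hg₁r⟩ := exists_glue (x⁻¹ * h * x) v (Ioo_subset_Icc_self hd')
    (hu_eq.trans hv₁.symm)
  obtain ⟨g', hg'l, hg'r⟩ := exists_glue g₁ g (Ioo_subset_Icc_self hp₂)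
    ((hg₁r _ (Ioo_subset_Icc_self hp₂) hd'p₂.le).trans hv₂)
  have hg'x : ∀ y ∈ Icc a (x⁻¹.fn d), g'.fn y = (x⁻¹ * h * x).fn y := fun y hy => by
    have hy' : y ∈ Icc a b := ⟨hy.1, hy.2.trans hd'.2.le⟩
    rw [hg'l y hy' (hy.2.trans hd'p₂.le), hg₁l y hy' hy.2]
  have hg'g : ∀ y ∈ Icc p₂ b, g'.fn y = g.fn y := fun y hy =>
    hg'r y ⟨hp₂.1.le.trans hy.1, hy.2⟩ hy.1
  refine ⟨g', ?_, ?_⟩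
  · have h1 := dist_le_of_eqOn (f := g) (g := g') hp₂.1.le hp₂.2.le le_rfl
      fun y hy => (hg'g y hy).symm
    have h2 := g.fn_strictMono.monotone hp₂p₀
    rw [fn_right] at h1
    linarith
  obtain ⟨k', hk', hk'k⟩ := hword g' fun y hy => hg'g y ⟨hp₂p.trans hy.1, hy.2⟩
  have hfmem : f ∈ Subgroup.closure {f, g'} := Subgroup.subset_closure (by simp)
  have hgmem : g' ∈ Subgroup.closure {f, g'} := Subgroup.subset_closure (by simp)
  have hemem : e ∈ Subgroup.closure {f, g'} := by
    rcases he with rfl | rfl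
    exacts [hfmem, inv_mem hfmem]
  -- Replacing `g` by `g'` turns `x` into `x'`. The power of `e` is unaffected, and `k'` agrees with
  -- `k` on `[k⁻¹ C, b]`, so the two inverses agree on `[C, b]`.
  set x' := k' * e ^ N with hx'
  have hx'mem : x' ∈ Subgroup.closure {f, g'} := mul_mem hk' (pow_mem hemem N)
  have hx'x : ∀ y ∈ Icc C b, x'.fn (x⁻¹.fn y) = y := fun y hy => by
    rw [hx', hx, mul_inv_rev, fn_mul, fn_mul, fn_fn_inv,
      hk'k ⟨k⁻¹.fn_strictMono.monotone hy.1, (k⁻¹.fn_mem_Icc ⟨hCmem.1.le.trans hy.1, hy.2⟩).2⟩,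
      fn_fn_inv]
  refine ⟨x' * g' * x'⁻¹, mul_mem (mul_mem hx'mem hgmem) (inv_mem hx'mem), ?_⟩
  have hEq : EqOn h.fn (x' * g' * x'⁻¹).fn (Icc c d) := fun y hy => by
    have hyab : y ∈ Icc a b := ⟨hc.1.le.trans hy.1, hy.2.trans hd.2.le⟩
    have h1 : x'⁻¹.fn y = x⁻¹.fn y := fn_inv_eq (hx'x y ⟨(min_le_left _ _).trans hy.1, hyab.2⟩)
    rw [fn_mul, fn_mul, h1, hg'x _ ⟨(x⁻¹.fn_mem_Icc hyab).1, x⁻¹.fn_strictMono.monotone hy.2⟩,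
      fn_mul (x⁻¹ * h) x, fn_mul x⁻¹ h, fn_fn_inv, hx'x]
    exact ⟨(min_le_right _ _).trans (h.fn_strictMono.monotone hy.1), (h.fn_mem_Icc hyab).2⟩
  have h1 := dist_le_of_eqOn hc.1.le hcd.le hd.2.le hEq
  linarith

/-- If `f` and `g` have no common fixed points in `(a, b)` and `f` moves a point close to `a`, then
`f` and `g` can be changed slightly so that `⟨f, g⟩` comes close to a given element. -/
lemma exists_near_of_fn_ne (hab : a < b) {f g : HPlusAC a b}
    (hfg : ∀ x ∈ Ioo a b, ¬ (f.fn x = x ∧ g.fn x = x)) {r : ℝ} (hr : r ∈ Ioo a b)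
    (hfr : f.fn r ≠ r) (h : HPlusAC a b) {ε : ℝ} (hε : 0 < ε) (hr' : f.fn r < a + ε / 2) :
    ∃ f' g' : HPlusAC a b, dist f f' < ε ∧ dist g g' < ε ∧
      ∃ w ∈ Subgroup.closure {f', g'}, dist h w < ε := by
  -- `u` has the same value as `f` at `r` but no fixed point in `(a, b)`; the gluing creates no new
  -- common fixed point and costs at most `2 (f r - a)`.
  obtain ⟨u, -, hur, hup, hdown⟩ := exists_move (b := b) le_rfl hr.1 hr.2 (f.fn_mem_Ioo hr).1
    (f.fn_mem_Ioo hr).2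
  obtain ⟨f', hf'l, hf'r⟩ := exists_glue u f (Ioo_subset_Icc_self hr) hur
  have hl : ∀ x ∈ Ioc a r, f'.fn x = u.fn x := fun x hx =>
    hf'l x ⟨hx.1.le, hx.2.trans hr.2.le⟩ hx.2
  have hdist : dist f f' < ε := by
    have h1 := dist_le_of_eqOn (f := f) (g := f') hr.1.le hr.2.le le_rfl
      fun y hy => (hf'r y ⟨hr.1.le.trans hy.1, hy.2⟩ hy.1).symm
    rw [fn_right] at h1
    linarith
  obtain ⟨e, he, her⟩ : ∃ e, (e = f' ∨ e = f'⁻¹) ∧ ∀ x ∈ Ioc a r, x < e.fn x := by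
    rcases hfr.lt_or_gt with hlt | hlt
    · refine ⟨f'⁻¹, Or.inr rfl, fun x hx => ?_⟩
      rw [← f'.fn_strictMono.lt_iff_lt, fn_fn_inv, hl x hx]
      exact hdown hlt x ⟨hx.1, hx.2.trans_lt hr.2⟩
    · refine ⟨f', Or.inl rfl, fun x hx => ?_⟩
      rw [hl x hx]
      exact hup hlt x ⟨hx.1, hx.2.trans_lt hr.2⟩
  have hfg' : ∀ x ∈ Ioo a b, ¬ (f'.fn x = x ∧ g.fn x = x) := by
    rintro x hx ⟨h1, h2⟩
    rcases le_total x r with hxr | hxr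
    · have h3 := her x ⟨hx.1, hxr⟩
      rcases he with rfl | rfl
      · exact h3.ne' h1
      · exact h3.ne' (fn_inv_eq h1)
    · rw [hf'r x (Ioo_subset_Icc_self hx) hxr] at h1
      exact hfg x hx ⟨h1, h2⟩
  obtain ⟨g', hg', w, hw, hwh⟩ := exists_near_of_no_common_fixed hab hfg' he hr her h hε
  exact ⟨f', g', hdist, hg', w, hw, hwh⟩

/-- Every pair can be changed slightly so that the group it generates comes close to a given
element. -/
lemma exists_near (hab : a < b) (f g h : HPlusAC a b) {ε : ℝ} (hε : 0 < ε) :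
    ∃ f' g' : HPlusAC a b, dist f f' < ε ∧ dist g g' < ε ∧
      ∃ w ∈ Subgroup.closure {f', g'}, dist h w < ε := by
  obtain ⟨f₁, g₁, hf₁, hg₁, hfg⟩ := exists_no_common_fixed_near hab f g (half_pos hε)
  obtain ⟨q, hq, hqε⟩ : ∃ q ∈ Ioo a b, q < a + ε / 2 / 2 := by
    obtain ⟨q, h1, h2⟩ := exists_between (lt_min hab (show a < a + ε / 2 / 2 by linarith))
    exact ⟨q, ⟨h1, h2.trans_le (min_le_left _ _)⟩, h2.trans_le (min_le_right _ _)⟩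
  have hrf := f₁⁻¹.fn_mem_Ioo hq
  have hrg := g₁⁻¹.fn_mem_Ioo hq
  -- Both generators map `r` close to `a`, and at least one of them moves it; the roles are
  -- exchanged if that is only `g₁`.
  set r := min (f₁⁻¹.fn q) (g₁⁻¹.fn q) with hr
  have hr' : r ∈ Ioo a b := ⟨lt_min hrf.1 hrg.1, (min_le_left _ _).trans_lt hrf.2⟩
  have h1 : f₁.fn r ≤ q := by
    have := f₁.fn_strictMono.monotone (min_le_left (f₁⁻¹.fn q) (g₁⁻¹.fn q))
    rwa [fn_fn_inv] at this
  have h2 : g₁.fn r ≤ q := by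
    have := g₁.fn_strictMono.monotone (min_le_right (f₁⁻¹.fn q) (g₁⁻¹.fn q))
    rwa [fn_fn_inv] at this
  by_cases hfr : f₁.fn r = r
  · have hgr : g₁.fn r ≠ r := fun h => hfg r hr' ⟨hfr, h⟩
    obtain ⟨g', f', hg', hf', w, hw, hwh⟩ := exists_near_of_fn_ne hab
      (fun x hx h => hfg x hx h.symm) hr' hgr h (half_pos hε) (by linarith)
    rw [pair_comm] at hw
    refine ⟨f', g', ?_, ?_, w, hw, by linarith⟩
    · linarith [dist_triangle f f₁ f']
    · linarith [dist_triangle g g₁ g']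
  · obtain ⟨f', g', hf', hg', w, hw, hwh⟩ := exists_near_of_fn_ne hab hfg hr' hfr h (half_pos hε)
      (by linarith)
    refine ⟨f', g', ?_, ?_, w, hw, by linarith⟩
    · linarith [dist_triangle f f₁ f']
    · linarith [dist_triangle g g₁ g']

/-- `f` fixes `l` and moves `p`, while `g` takes `l` to `p`; the two products differ at `l`. -/
lemma exists_not_commute (hab : a < b) : ∃ f g : HPlusAC a b, f * g ≠ g * f := by
  obtain ⟨l, hal, hlb⟩ := exists_between hab
  obtain ⟨p, hlp, hpb⟩ := exists_between hlb
  obtain ⟨f, hf, hfp⟩ := exists_move_up hal.le hlp (exists_between hpb).choose_spec.1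
    (exists_between hpb).choose_spec.2
  obtain ⟨g, -, hg, -⟩ := exists_move_up (a := a) le_rfl hal hlp hpb
  refine ⟨f, g, fun h => ?_⟩
  have h1 := congrArg (fun k : HPlusAC a b => k.fn l) h
  simp only [fn_mul, hg, hf l ⟨hal.le, le_rfl⟩] at h1
  exact (hfp.2 p ⟨hlp, hpb⟩).ne' h1

end HPlusAC

/-! ### Baire category and ranks -/

/-- An element of `⟨p.1, p.2⟩` depends continuously on `p`. -/
lemma exists_continuous_word {G : Type*} [Group G] [TopologicalSpace G] [IsTopologicalGroup G]
    {p : G × G} {w : G} (hw : w ∈ Subgroup.closure {p.1, p.2}) :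
    ∃ W : G × G → G, Continuous W ∧ W p = w ∧ ∀ q, W q ∈ Subgroup.closure {q.1, q.2} := by
  induction hw using Subgroup.closure_induction with
  | mem x hx =>
    rcases hx with rfl | rfl
    · exact ⟨Prod.fst, continuous_fst, rfl, fun q => Subgroup.subset_closure (by simp)⟩
    · exact ⟨Prod.snd, continuous_snd, rfl, fun q => Subgroup.subset_closure (by simp)⟩
  | one => exact ⟨fun _ => 1, continuous_const, rfl, fun _ => one_mem _⟩
  | mul x y _ _ hx hy =>
    obtain ⟨U, hU, rfl, hU'⟩ := hx
    obtain ⟨V, hV, rfl, hV'⟩ := hy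
    exact ⟨fun q => U q * V q, hU.mul hV, rfl, fun q => mul_mem (hU' q) (hV' q)⟩
  | inv x _ hx =>
    obtain ⟨U, hU, rfl, hU'⟩ := hx
    exact ⟨fun q => (U q)⁻¹, hU.inv, rfl, fun q => inv_mem (hU' q)⟩

lemma isOpen_setOf_exists_mem_closure_pair {G : Type*} [Group G] [TopologicalSpace G]
    [IsTopologicalGroup G] {U : Set G} (hU : IsOpen U) :
    IsOpen {p : G × G | ∃ w ∈ Subgroup.closure {p.1, p.2}, w ∈ U} := by
  rw [isOpen_iff_mem_nhds]
  rintro p ⟨w, hw, hwU⟩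
  obtain ⟨W, hW, rfl, hW'⟩ := exists_continuous_word hw
  filter_upwards [hW.continuousAt.preimage_mem_nhds (hU.mem_nhds hwU)] with q hq
  exact ⟨W q, hW' q, hq⟩

/-- Density need only be tested on a countable basis, which exhibits the set as a countable
intersection. -/
lemma setOf_dense_closure_pair_eq {G : Type*} [Group G] [TopologicalSpace G]
    [SecondCountableTopology G] :
    {p : G × G | Dense (Subgroup.closure {p.1, p.2} : Set G)} =
      ⋂ U ∈ TopologicalSpace.countableBasis G,
        {p : G × G | ∃ w ∈ Subgroup.closure {p.1, p.2}, w ∈ U} := by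
  ext p
  simp only [mem_ofPred_eq, mem_iInter,
    (TopologicalSpace.isBasis_countableBasis G).dense_iff]
  refine ⟨fun h U hU => ?_, fun h U hU _ => ?_⟩
  · obtain ⟨w, hw, hw'⟩ := h U hU (TopologicalSpace.nonempty_of_mem_countableBasis hU)
    exact ⟨w, hw', hw⟩
  · obtain ⟨w, hw, hw'⟩ := h U hU
    exact ⟨w, hw', hw⟩

lemma denseGenerators_two_eq {G : Type*} [Group G] [TopologicalSpace G] :
    denseGenerators G 2 = (Homeomorph.finTwoArrow : (Fin 2 → G) ≃ₜ G × G) ⁻¹'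
      {p | Dense (Subgroup.closure {p.1, p.2} : Set G)} := by
  ext g
  have : range g = {g 0, g 1} := by
    ext x
    simp [Fin.exists_fin_two, eq_comm]
  simp only [denseGenerators, mem_ofPred_eq, mem_preimage, this]
  rfl

/-- A Hausdorff group that is topologically generated by at most one element is commutative. -/
lemma IsTopologicallyGenerated.commute {G : Type*} [Group G] [TopologicalSpace G]
    [IsTopologicalGroup G] [T2Space G] {n : ℕ} (hn : n ≤ 1) (h : IsTopologicallyGenerated G n)
    (x y : G) : x * y = y * x := by
  obtain ⟨g, hg⟩ := h
  change Dense (Subgroup.closure (range g) : Set G) at hg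
  have : Subsingleton (Fin n) := Fin.subsingleton_iff_le_one.2 hn
  have hcomm : ∀ x ∈ Subgroup.closure (range g), ∀ y ∈ Subgroup.closure (range g),
      x * y = y * x := by
    have := Subgroup.isMulCommutative_closure (k := range g) (by
      rintro _ ⟨i, rfl⟩ _ ⟨j, rfl⟩
      rw [Subsingleton.elim i j])
    exact fun x hx y hy => setLike_mul_comm hx hy
  -- Commutation is a closed condition on `G × G`, so it passes from a dense subgroup to the whole
  -- group.
  have hclosed : IsClosed {p : G × G | p.1 * p.2 = p.2 * p.1} :=
    isClosed_eq (by fun_prop) (by fun_prop)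
  have hsub : (Subgroup.closure (range g) : Set G) ×ˢ (Subgroup.closure (range g) : Set G) ⊆
      {p : G × G | p.1 * p.2 = p.2 * p.1} := fun p hp => hcomm _ hp.1 _ hp.2
  exact hclosed.closure_subset_iff.2 hsub ((hg.prod hg) (x, y))

/-- By Baire a comeagre subset of the nonempty Polish space `G ^ n` is nonempty. Lower bounds for
the topological rank thus carry over to the generic one. -/
lemma IsGenericallyGenerated.isTopologicallyGenerated {G : Type*} [Group G] [TopologicalSpace G]
    [PolishSpace G] {n : ℕ} (h : IsGenericallyGenerated G n) : IsTopologicallyGenerated G n :=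
  (dense_of_mem_residual h).nonempty

lemma HPlusAC.not_isTopologicallyGenerated {a b : ℝ} (hab : a < b) {n : ℕ} (hn : n ≤ 1) :
    ¬ IsTopologicallyGenerated (HPlusAC a b) n := fun h => by
  obtain ⟨f, g, hfg⟩ := exists_not_commute hab
  exact hfg (h.commute hn f g)

theorem mainTheorem1 (a b : ℝ) (hab : a < b) :
    IsTopologicalGroup (HPlusAC a b) ∧
    PolishSpace (HPlusAC a b) ∧
    IsGδ {p : HPlusAC a b × HPlusAC a b |
      Dense (Subgroup.closure {p.1, p.2} : Set (HPlusAC a b))} ∧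
    Dense {p : HPlusAC a b × HPlusAC a b |
      Dense (Subgroup.closure {p.1, p.2} : Set (HPlusAC a b))} ∧
    IsGenericallyGenerated (HPlusAC a b) 2 ∧
    ¬ IsTopologicallyGenerated (HPlusAC a b) 1 ∧
    topologicalRank (HPlusAC a b) = 2 ∧
    genericRank (HPlusAC a b) = 2 := by
  have hopen : ∀ U ∈ TopologicalSpace.countableBasis (HPlusAC a b),
      IsOpen {p : HPlusAC a b × HPlusAC a b | ∃ w ∈ Subgroup.closure {p.1, p.2}, w ∈ U} :=
    fun U hU => isOpen_setOf_exists_mem_closure_pair (TopologicalSpace.isOpen_of_mem_countableBasis hU)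
  have hGδ : IsGδ {p : HPlusAC a b × HPlusAC a b |
      Dense (Subgroup.closure {p.1, p.2} : Set (HPlusAC a b))} := by
    rw [setOf_dense_closure_pair_eq]
    exact IsGδ.biInter (TopologicalSpace.countable_countableBasis _) fun U hU => (hopen U hU).isGδ
  have hdense : Dense {p : HPlusAC a b × HPlusAC a b |
      Dense (Subgroup.closure {p.1, p.2} : Set (HPlusAC a b))} := by
    rw [setOf_dense_closure_pair_eq]
    refine dense_biInter_of_isOpen hopen (TopologicalSpace.countable_countableBasis _) fun U hU => ?_
    obtain ⟨h, hh⟩ := TopologicalSpace.nonempty_of_mem_countableBasis hU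
    obtain ⟨δ, hδ, hball⟩ := Metric.isOpen_iff.1
      (TopologicalSpace.isOpen_of_mem_countableBasis hU) h hh
    rw [Metric.dense_iff]
    rintro ⟨f, g⟩ ε hε
    obtain ⟨f', g', hf', hg', w, hw, hwh⟩ := HPlusAC.exists_near hab f g h (lt_min hε hδ)
    refine ⟨(f', g'), ?_, w, hw, hball ?_⟩
    · rw [Metric.mem_ball, dist_comm, Prod.dist_eq]
      exact max_lt (hf'.trans_le (min_le_left _ _)) (hg'.trans_le (min_le_left _ _))
    · rw [Metric.mem_ball, dist_comm]
      exact hwh.trans_le (min_le_right _ _)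
  have hgen : IsGenericallyGenerated (HPlusAC a b) 2 := by
    rw [IsGenericallyGenerated, denseGenerators_two_eq]
    exact residual_of_dense_Gδ (hGδ.preimage (Homeomorph.continuous _))
      (hdense.preimage (Homeomorph.isOpenMap _))
  have hnot : ∀ n, IsTopologicallyGenerated (HPlusAC a b) n → ((2 : ℕ) : ℕ∞) ≤ n := fun n hn => by
    by_contra hlt
    refine HPlusAC.not_isTopologicallyGenerated hab (n := n) ?_ hn
    rw [Nat.cast_le] at hlt
    omega
  refine ⟨inferInstance, inferInstance, hGδ, hdense, hgen,
    HPlusAC.not_isTopologicallyGenerated hab le_rfl, le_antisymm ?_ ?_, le_antisymm ?_ ?_⟩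
  · exact iInf₂_le 2 hgen.isTopologicallyGenerated
  · exact le_iInf₂ hnot
  · exact iInf₂_le 2 hgen
  · exact le_iInf₂ fun n hn => hnot n hn.isTopologicallyGenerated
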